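/- Let $k$ be a field, let $0\le r\le n$ be integers, let $R=k[x_0,\dots,x_n]$ with the standard grading, and let $P_0,\dots,P_r$ be points of $\mathbb P^n_k$ in general position, i.e. represented by linearly independent vectors of $k^{n+1}$. Let $\mathfrak p_i\subset R$ be the homogeneous ideal of $P_i$ (generated by the forms vanishing at $P_i$), and let $I=\mathfrak p_0^3\cap\cdots\cap\mathfrak p_r^3$ be the ideal of the $r+1$ triple points. Then $R/I$ has a minimal graded free resolution by finitely generated graded free modules, and its graded Betti numbers $\beta_{q,j}(R/I)$ (the number of summands $R(-j)$ in homological degree $q$ of any such resolution) are as follows. For $q\ge 1$, \[ \beta_{q,q+2}(R/I) = \binom{n-r+2}{q+2}\binom{q+1}{q-1}, \] \[ \beta_{q,q+3}(R/I) = \sum_{i=0}^{r-1} (r-i)\binom{n-r+1}{2}\binom{n-i-1}{q-1} + \sum_{i=0}^{r-2} \binom{r-i}{2}(n-r)\binom{n-i-2}{q-1} + \sum_{i=0}^{r-3}\binom{r-i}{3}\binom{n-i-3}{q-1}, \] \[ \beta_{q,q+4}(R/I)=2\binom{r+1}{3}\binom{n-1}{q-1} + \binom{r+1}{3}\binom{n-2}{q-1}+(n-r)\binom{r+1}{2}\binom{n-1}{q-1},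 \] \[ \beta_{q,q+5}(R/I)=\binom{r+1}{2}\binom{n-1}{q-1}. \] Moreover $\beta_{0,0}(R/I)=1$, and all other graded Betti numbers of $R/I$ are zero. (Sums whose upper limit is negative are zero, and in the products above a term with a vanishing factor is zero.) -/

import Mathlib

namespace FatPoints

open MvPolynomial

/-- The degree `j` part of the standard graded polynomial ring `k[x_s : s ∈ σ]`, for `j : ℤ`
(it is zero in negative degrees). -/
noncomputable def gradedPiece (σ k : Type*) [Field k] : ℤ → Submodule k (MvPolynomial σ k)
  | Int.ofNat m => homogeneousSubmodule σ k m
  | Int.negSucc _ => ⊥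

/-- The degree `j` part of the graded module `R/I`: the image of the degree `j` part of `R`. -/
noncomputable def quotientPiece {σ k : Type*} [Field k] (I : Ideal (MvPolynomial σ k)) (j : ℤ) :
    Submodule k (MvPolynomial σ k ⧸ I) :=
  (gradedPiece σ k j).map (Ideal.Quotient.mkₐ k I).toLinearMap

/-- The homogeneous maximal ideal of the polynomial ring, generated by the variables. -/
noncomputable def irrelevantIdeal (σ k : Type*) [Field k] : Ideal (MvPolynomial σ k) :=
  Ideal.span (Set.range X)

/-- A minimal graded free resolution, by finitely generated graded free modules,
`⋯ → F_2 → F_1 → F_0 → M → 0` of a module `M` over `R = k[x_s : s ∈ σ]` whose degree `j` part is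
`ℳ j`. Here `F_i = ⨁_b R(-shift i b)` is free on `rank i` basis vectors, the `b`-th of which has
degree `shift i b`, and all maps are homogeneous of degree zero. -/
structure MinimalGradedFreeResolution {σ k : Type*} [Field k] {M : Type*} [AddCommGroup M]
    [Module k M] [Module (MvPolynomial σ k) M] (ℳ : ℤ → Submodule k M) where
  /-- the rank of `F_i` -/
  rank : ℕ → ℕ
  /-- the degrees of the basis vectors of `F_i` -/
  shift : (i : ℕ) → Fin (rank i) → ℤ
  /-- the differential `F_{i+1} → F_i` -/
  d : (i : ℕ) →
    (Fin (rank (i + 1)) → MvPolynomial σ k) →ₗ[MvPolynomial σ k] (Fin (rank i) → MvPolynomial σ k)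
  /-- the augmentation `F_0 → M` -/
  ε : (Fin (rank 0) → MvPolynomial σ k) →ₗ[MvPolynomial σ k] M
  /-- The `c`-th coordinate of the image of a basis vector of degree `s` is homogeneous of
  degree `s - shift i c`, so that the image is homogeneous of degree `s` in `F_i`. -/
  d_homogeneous : ∀ i b c,
    d i (Pi.single b 1) c ∈ gradedPiece σ k (shift (i + 1) b - shift i c)
  ε_homogeneous : ∀ b, ε (Pi.single b 1) ∈ ℳ (shift 0 b)
  ε_surjective : Function.Surjective ε
  exact_zero : Function.Exact (d 0) ε
  exact_succ : ∀ i, Function.Exact (d (i + 1)) (d i)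
  /-- minimality: the image of `F_{i+1}` lies in `𝔪 F_i` -/
  minimal : ∀ i, LinearMap.range (d i) ≤
    irrelevantIdeal σ k • (⊤ : Submodule (MvPolynomial σ k) (Fin (rank i) → MvPolynomial σ k))

/-- The graded Betti number `β_{i,j}` read off from a minimal graded free resolution: the number
of summands `R(-j)` in `F_i`. -/
def MinimalGradedFreeResolution.betti {σ k : Type*} [Field k] {M : Type*} [AddCommGroup M]
    [Module k M] [Module (MvPolynomial σ k) M] {ℳ : ℤ → Submodule k M}
    (F : MinimalGradedFreeResolution (σ := σ) ℳ) (i : ℕ) (j : ℤ) : ℕ :=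
  (Finset.univ.filter fun b => F.shift i b = j).card

/-- The homogeneous ideal of a point of `ℙⁿ`: the ideal generated by all forms vanishing there. -/
noncomputable def pointIdeal {k : Type*} [Field k] {n : ℕ} (P : Projectivization k (Fin (n + 1) → k)) :
    Ideal (MvPolynomial (Fin (n + 1)) k) :=
  Ideal.span {f | (∃ m : ℕ, f.IsHomogeneous m) ∧ eval P.rep f = 0}

/-- The ideal `⋂ 𝔭_i ^ a_i` of the fat points `(P_i, a_i)`. -/
noncomputable def fatPointIdeal {k : Type*} [Field k] {n r : ℕ}
    (P : Fin (r + 1) → Projectivization k (Fin (n + 1) → k)) (a : Fin (r + 1) → ℕ) :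
    Ideal (MvPolynomial (Fin (n + 1)) k) :=
  ⨅ i, pointIdeal (P i) ^ a i

end FatPoints

/-! Linearly independent representatives extend to a basis, so a linear change of variables moves
the points to coordinate points. Let `S` be the set of the corresponding variables and `T` its
complement. The ideal of a coordinate point is generated by the other variables, and its cube
contains `x^a` exactly when `a i + 3 ≤ deg a`. So `I` becomes the monomial ideal of all `a` with `a
i + 3 ≤ deg a` for every `i ∈ S`.

This ideal is built up one monomial at a time, in such an order that each new monomial `m`, of
degree `d`, has a colon ideal `I' : m` generated by a set `V` of variables. The exact sequence `0 →
R/(I' : m)(-d) → R/I' → R/(I' + m) → 0` resolves `R/(I' + m)` by a mapping cone of a Koszul complex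
over the resolution already built. The Koszul vectors that map to homological degree `q` have degree
`q + d`, while the vectors already there have smaller degree because generators are added by
increasing degree. Hence the connecting maps have no constant entries, the cone is minimal, and `m`
contributes `(V.card).choose q` to `β_{q+1,q+d}`. This is `HasBetti.union_image`.

The generators come in four degrees: cubic monomials in `T`; quartics squarefree on `S`; quintics
`x_i^2 x_j^2 x_v`; and sextics `x_i^3 x_j^3`. Nothing else is needed, since a monomial of degree at
least four in the ideal can be divided by a variable unless `a i + 3 = deg a` holds for two points
(`exists_le_degree_add_one`). The four Betti strands are the sums of the binomials over these
families.

Finally, `Resolution.betti_eq` shows that every minimal graded free resolution has the same Betti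
numbers, by comparing two of them up to homotopy. -/

namespace FatPoints

open MvPolynomial

/-! ### Homogeneous components, graded ideals and homogeneous matrices. -/

section Grading

variable {σ k : Type*} [Field k]

/-- Covers both signs of `j` at once, so that degrees of matrix entries can be subtracted in `ℤ`
without case distinctions. -/
theorem mem_gradedPiece {j : ℤ} {f : MvPolynomial σ k} :
    f ∈ gradedPiece σ k j ↔ ∀ c, coeff c f ≠ 0 → (c.degree : ℤ) = j := by
  rcases j with m | m
  · simp only [gradedPiece, mem_homogeneousSubmodule]
    constructor
    · intro h c hc
      by_contra hne
      exact hc (h.coeff_eq_zero fun h' => hne (by simp [h']))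
    · intro h c hc
      have := h c hc
      have h2 := congrFun (congrArg DFunLike.coe (Finsupp.degree_eq_weight_one (σ := σ) (R := ℕ))) c
      exact h2.symm.trans (by simpa using this)
  · simp only [gradedPiece, Submodule.mem_bot]
    constructor
    · rintro rfl c hc
      simp at hc
    · intro h
      ext c
      by_contra hc
      have := h c (by simpa using hc)
      omega

/-- The projection of the polynomial ring onto its degree `j` part. -/
noncomputable def gradedComponent (j : ℤ) : MvPolynomial σ k →ₗ[k] MvPolynomial σ k :=
  if 0 ≤ j then homogeneousComponent j.toNat else 0

theorem coeff_gradedComponent (j : ℤ) (f : MvPolynomial σ k) (c : σ →₀ ℕ) :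
    coeff c (gradedComponent j f) = if (c.degree : ℤ) = j then coeff c f else 0 := by
  unfold gradedComponent
  split_ifs with h1 h2 h2
  · rw [coeff_homogeneousComponent, if_pos (by omega)]
  · rw [coeff_homogeneousComponent, if_neg (by omega)]
  · omega
  · simp

theorem gradedComponent_mem (j : ℤ) (f : MvPolynomial σ k) :
    gradedComponent j f ∈ gradedPiece σ k j := by
  rw [mem_gradedPiece]
  intro c hc
  by_contra h
  exact hc (by rw [coeff_gradedComponent, if_neg h])

theorem gradedComponent_of_mem {j : ℤ} {f : MvPolynomial σ k} (hf : f ∈ gradedPiece σ k j) :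
    gradedComponent j f = f := by
  ext c
  rw [coeff_gradedComponent]
  split_ifs with h
  · rfl
  · by_contra hc
    exact h (mem_gradedPiece.1 hf c fun h0 => hc h0.symm)

theorem mul_gradedComponent {p q : ℤ} {f : MvPolynomial σ k} (hf : f ∈ gradedPiece σ k p)
    (g : MvPolynomial σ k) :
    f * gradedComponent q g = gradedComponent (p + q) (f * g) := by
  classical
  ext c
  rw [coeff_gradedComponent, coeff_mul, coeff_mul]
  split_ifs with h
  · refine Finset.sum_congr rfl fun x hx => ?_
    rw [coeff_gradedComponent]
    by_cases h0 : coeff x.1 f = 0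
    · simp [h0]
    · have h1 := mem_gradedPiece.1 hf _ h0
      rw [← Finset.HasAntidiagonal.mem_antidiagonal.1 hx, map_add] at h
      push_cast at h
      rw [if_pos (by omega)]
  · refine Finset.sum_eq_zero fun x hx => ?_
    rw [coeff_gradedComponent]
    by_cases h0 : coeff x.1 f = 0
    · simp [h0]
    · have h1 := mem_gradedPiece.1 hf _ h0
      rw [← Finset.HasAntidiagonal.mem_antidiagonal.1 hx, map_add] at h
      push_cast at h
      rw [if_neg (by omega), mul_zero]

theorem mul_mem_gradedPiece {p q : ℤ} {f g : MvPolynomial σ k} (hf : f ∈ gradedPiece σ k p)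
    (hg : g ∈ gradedPiece σ k q) : f * g ∈ gradedPiece σ k (p + q) := by
  rw [← gradedComponent_of_mem hg, mul_gradedComponent hf]
  exact gradedComponent_mem _ _

theorem one_mem_gradedPiece : (1 : MvPolynomial σ k) ∈ gradedPiece σ k 0 :=
  isHomogeneous_one σ k

theorem constantCoeff_eq_zero_of_mem {j : ℤ} (hj : j ≠ 0) {f : MvPolynomial σ k}
    (hf : f ∈ gradedPiece σ k j) : constantCoeff f = 0 := by
  by_contra h
  exact hj (by simpa using (mem_gradedPiece.1 hf 0 h).symm)

theorem mem_irrelevantIdeal {f : MvPolynomial σ k} :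
    f ∈ irrelevantIdeal σ k ↔ constantCoeff f = 0 := by
  rw [irrelevantIdeal, ← Set.image_univ, mem_ideal_span_X_image]
  constructor
  · intro h
    by_contra h0
    obtain ⟨i, -, hi⟩ := h 0 (by simpa [constantCoeff_eq] using h0)
    exact hi rfl
  · intro h c hc
    by_contra! hall
    have : c = 0 := Finsupp.ext fun i => hall i trivial
    subst this
    exact (mem_support_iff.1 hc) h

/-- An ideal containing all homogeneous components of its elements. -/
def IsGraded (I : Ideal (MvPolynomial σ k)) : Prop :=
  ∀ f ∈ I, ∀ j, gradedComponent j f ∈ I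

/-- A matrix of a degree zero map from `⨁_b R(-s b)` to `⨁_c R(-t c)`. -/
def IsHomogMatrix {ι κ : Type*} (s : κ → ℤ) (t : ι → ℤ) (A : Matrix ι κ (MvPolynomial σ k)) :
    Prop :=
  ∀ c b, A c b ∈ gradedPiece σ k (s b - t c)

theorem IsHomogMatrix.add_const {ι κ : Type*} {s : κ → ℤ} {t : ι → ℤ}
    {A : Matrix ι κ (MvPolynomial σ k)} (hA : IsHomogMatrix s t A) (d : ℤ) :
    IsHomogMatrix (fun b => s b + d) (fun c => t c + d) A := by
  intro c b
  rw [add_sub_add_right_eq_sub]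
  exact hA c b

theorem IsHomogMatrix.mul {ι κ μ : Type*} [Fintype κ] {s : κ → ℤ} {t : ι → ℤ} {w : μ → ℤ}
    {A : Matrix ι κ (MvPolynomial σ k)} {B : Matrix κ μ (MvPolynomial σ k)}
    (hA : IsHomogMatrix s t A) (hB : IsHomogMatrix w s B) : IsHomogMatrix w t (A * B) := by
  intro c b
  rw [Matrix.mul_apply]
  refine Submodule.sum_mem _ fun x _ => ?_
  have := mul_mem_gradedPiece (hA c x) (hB x b)
  rwa [show s x - t c + (w b - s x) = w b - t c by ring] at this

/-- A homogeneous system of linear equations that has a solution has a homogeneous solution. -/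
theorem IsHomogMatrix.exists_mul_eq {ι κ μ : Type*} [Fintype κ] {s : κ → ℤ} {t : ι → ℤ}
    {w : μ → ℤ} {A : Matrix ι κ (MvPolynomial σ k)} {Y : Matrix ι μ (MvPolynomial σ k)}
    (hA : IsHomogMatrix s t A) (hY : IsHomogMatrix w t Y)
    (h : ∀ b, ∃ x, A.mulVec x = fun i => Y i b) :
    ∃ Z : Matrix κ μ (MvPolynomial σ k), IsHomogMatrix w s Z ∧ A * Z = Y := by
  choose x hx using h
  -- Taking the component of degree `w b - s c` of each coordinate commutes with multiplication by
  -- the homogeneous `A`, so the truncated vector still solves the system.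
  refine ⟨Matrix.of fun c b => gradedComponent (w b - s c) (x b c),
    fun c b => gradedComponent_mem _ _, ?_⟩
  ext1 i b
  rw [Matrix.mul_apply, ← gradedComponent_of_mem (hY i b), ← congrFun (hx b) i, Matrix.mulVec,
    dotProduct, map_sum]
  refine Finset.sum_congr rfl fun c _ => ?_
  rw [Matrix.of_apply, mul_gradedComponent (hA i c)]
  congr 2
  ring

/-- The version of `IsHomogMatrix.exists_mul_eq` for one equation modulo a graded ideal. -/
theorem IsGraded.exists_dotProduct_sub_mem {κ μ : Type*} [Fintype κ] {s : κ → ℤ}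
    {w : μ → ℤ} {I : Ideal (MvPolynomial σ k)} (hI : IsGraded I) {u : κ → MvPolynomial σ k}
    {y : μ → MvPolynomial σ k}
    (hu : ∀ c, u c ∈ gradedPiece σ k (s c)) (hy : ∀ b, y b ∈ gradedPiece σ k (w b))
    (h : ∀ b, ∃ x, u ⬝ᵥ x - y b ∈ I) :
    ∃ Z : Matrix κ μ (MvPolynomial σ k), IsHomogMatrix w s Z ∧ ∀ b, Matrix.vecMul u Z b - y b ∈ I := by
  choose x hx using h
  refine ⟨Matrix.of fun c b => gradedComponent (w b - s c) (x b c),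
    fun c b => gradedComponent_mem _ _, fun b => ?_⟩
  have := hI _ (hx b) (w b)
  rw [map_sub, gradedComponent_of_mem (hy b)] at this
  convert this using 2
  rw [dotProduct, map_sum]
  refine Finset.sum_congr rfl fun c _ => ?_
  change u c * gradedComponent (w b - s c) (x b c) = _
  rw [mul_gradedComponent (hu c)]
  congr 2
  ring

end Grading

/-! ### Resolutions in matrix form and uniqueness of Betti numbers. -/

/-- A minimal graded free resolution of `R/I`, given by the matrices `A q` of its differentials and
by the lifts `u b` to `R` of the images of the basis vectors of `F_0`. -/
structure Resolution {σ k : Type*} [Field k] (I : Ideal (MvPolynomial σ k)) where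
  ι : ℕ → Type
  fin : ∀ q, Fintype (ι q)
  dec : ∀ q, DecidableEq (ι q)
  deg : ∀ q, ι q → ℤ
  A : ∀ q, Matrix (ι q) (ι (q + 1)) (MvPolynomial σ k)
  u : ι 0 → MvPolynomial σ k
  homog : ∀ q, IsHomogMatrix (deg (q + 1)) (deg q) (A q)
  homog_u : ∀ b, u b ∈ gradedPiece σ k (deg 0 b)
  surj : ∀ y, ∃ x, u ⬝ᵥ x - y ∈ I
  exact_zero : ∀ x, u ⬝ᵥ x ∈ I ↔ ∃ y, (A 0).mulVec y = x
  exact_succ : ∀ q x, (A q).mulVec x = 0 ↔ ∃ y, (A (q + 1)).mulVec y = x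
  minimal : ∀ q c b, constantCoeff (A q c b) = 0

attribute [instance] Resolution.fin Resolution.dec

/-- The number of basis vectors of degree `j` in homological degree `q`. -/
def Resolution.betti {σ k : Type*} [Field k] {I : Ideal (MvPolynomial σ k)} (F : Resolution I)
    (q : ℕ) (j : ℤ) : ℕ :=
  (Finset.univ.filter fun b => F.deg q b = j).card

namespace Resolution

variable {σ k : Type*} [Field k] {I : Ideal (MvPolynomial σ k)}

theorem A_mul_A (F : Resolution I) (q : ℕ) : F.A q * F.A (q + 1) = 0 := by
  refine Matrix.ext_of_mulVec_single fun b => ?_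
  rw [← Matrix.mulVec_mulVec, Matrix.zero_mulVec]
  exact (F.exact_succ q _).2 ⟨_, rfl⟩

theorem dotProduct_mulVec_mem (F : Resolution I) (y : F.ι 1 → MvPolynomial σ k) :
    F.u ⬝ᵥ (F.A 0).mulVec y ∈ I :=
  (F.exact_zero _).2 ⟨y, rfl⟩

/-- A homogeneous map `G_q → F_q` that respects the images of the differentials lifts to
`G_{q+1} → F_{q+1}`. -/
theorem exists_lift {J : Ideal (MvPolynomial σ k)} (F : Resolution I) (G : Resolution J) (d : ℤ)
    {q : ℕ} {φ : Matrix (F.ι q) (G.ι q) (MvPolynomial σ k)}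
    (hφ : IsHomogMatrix (fun b => G.deg q b + d) (F.deg q) φ)
    (hφ' : ∀ x, ∃ y, (F.A q).mulVec y = φ.mulVec ((G.A q).mulVec x)) :
    ∃ φ' : Matrix (F.ι (q + 1)) (G.ι (q + 1)) (MvPolynomial σ k),
      IsHomogMatrix (fun b => G.deg (q + 1) b + d) (F.deg (q + 1)) φ' ∧
      F.A q * φ' = φ * G.A q ∧
      ∀ x, ∃ y, (F.A (q + 1)).mulVec y = φ'.mulVec ((G.A (q + 1)).mulVec x) := by
  obtain ⟨φ', h1, h2⟩ := (F.homog q).exists_mul_eq (hφ.mul ((G.homog q).add_const d))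
    fun b => by
      obtain ⟨y, hy⟩ := hφ' (Pi.single b 1)
      refine ⟨y, ?_⟩
      rw [hy, Matrix.mulVec_mulVec, Matrix.mulVec_single_one]
      rfl
  refine ⟨φ', h1, h2, fun x => ?_⟩
  rw [← F.exact_succ, Matrix.mulVec_mulVec, h2, Matrix.mulVec_mulVec, Matrix.mul_assoc,
    G.A_mul_A, Matrix.mul_zero, Matrix.zero_mulVec]

/-- In each homological degree `q`, two resolutions have comparison maps `φ`, `ψ` such that
`ψ ∘ φ` is homotopic to the identity on the image of the differential. -/
theorem exists_comparison (hI : IsGraded I) (F G : Resolution I) (q : ℕ) :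
    ∃ (φ : Matrix (G.ι q) (F.ι q) (MvPolynomial σ k)) (ψ : Matrix (F.ι q) (G.ι q) (MvPolynomial σ k))
      (h : Matrix (F.ι (q + 1)) (F.ι q) (MvPolynomial σ k)),
      IsHomogMatrix (F.deg q) (G.deg q) φ ∧ IsHomogMatrix (G.deg q) (F.deg q) ψ ∧
      (∀ x, ∃ y, (G.A q).mulVec y = φ.mulVec ((F.A q).mulVec x)) ∧
      (∀ x, ∃ y, (F.A q).mulVec y = ψ.mulVec ((G.A q).mulVec x)) ∧
      (ψ * φ - 1) * F.A q = F.A q * h * F.A q ∧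
      ∀ c b, constantCoeff ((ψ * φ - 1 : Matrix (F.ι q) (F.ι q) (MvPolynomial σ k)) c b) = 0 := by
  have minimal_mul : ∀ {q : ℕ} {μ : Type} [Fintype μ]
      (X : Matrix (F.ι (q + 1)) μ (MvPolynomial σ k)) c b,
      constantCoeff ((F.A q * X) c b) = 0 := by
    intro q μ _ X c b
    rw [Matrix.mul_apply, map_sum]
    exact Finset.sum_eq_zero fun x _ => by rw [map_mul, F.minimal, zero_mul]
  have mul_minimal : ∀ {q : ℕ} {μ : Type}
      (X : Matrix μ (F.ι q) (MvPolynomial σ k)) c b,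
      constantCoeff ((X * F.A q) c b) = 0 := by
    intro q μ X c b
    rw [Matrix.mul_apply, map_sum]
    exact Finset.sum_eq_zero fun x _ => by rw [map_mul, F.minimal, mul_zero]
  induction q with
  | zero =>
    have lift : ∀ F G : Resolution I, ∃ φ : Matrix (G.ι 0) (F.ι 0) (MvPolynomial σ k),
        IsHomogMatrix (F.deg 0) (G.deg 0) φ ∧ ∀ x, G.u ⬝ᵥ φ.mulVec x - F.u ⬝ᵥ x ∈ I := by
      intro F G
      obtain ⟨φ, h1, h2⟩ := hI.exists_dotProduct_sub_mem G.homog_u F.homog_u fun b => G.surj _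
      refine ⟨φ, h1, fun x => ?_⟩
      rw [Matrix.dotProduct_mulVec, ← sub_dotProduct]
      exact Ideal.sum_mem _ fun c _ => Ideal.mul_mem_right _ _ (h2 c)
    obtain ⟨φ, hφ, hφ'⟩ := lift F G
    obtain ⟨ψ, hψ, hψ'⟩ := lift G F
    have key : ∀ x, F.u ⬝ᵥ ((ψ * φ - 1).mulVec x) ∈ I := by
      intro x
      rw [Matrix.sub_mulVec, Matrix.one_mulVec, ← Matrix.mulVec_mulVec, dotProduct_sub]
      have := Ideal.add_mem _ (hψ' (φ.mulVec x)) (hφ' x)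
      rwa [sub_add_sub_cancel] at this
    have : ∀ b, ∃ y, (F.A 0).mulVec y = (ψ * φ - 1).mulVec (Pi.single b 1) :=
      fun b => (F.exact_zero _).1 (key _)
    choose H hH using this
    have hHm : F.A 0 * (Matrix.of fun c b => H b c) = ψ * φ - 1 := by
      refine Matrix.ext_of_mulVec_single fun b => ?_
      rw [← hH b, ← Matrix.mulVec_mulVec]
      congr 1
      ext c : 1
      simp
    refine ⟨φ, ψ, Matrix.of fun c b => H b c, hφ, hψ, fun x => ?_, fun x => ?_, by rw [hHm], ?_⟩
    · rw [← G.exact_zero]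
      simpa using Ideal.add_mem _ (hφ' ((F.A 0).mulVec x)) (F.dotProduct_mulVec_mem x)
    · rw [← F.exact_zero]
      simpa using Ideal.add_mem _ (hψ' ((G.A 0).mulVec x)) (G.dotProduct_mulVec_mem x)
    · rw [← hHm]
      exact minimal_mul _
  | succ q ih =>
    obtain ⟨φ, ψ, h, hφ, hψ, hφ', hψ', hh, -⟩ := ih
    obtain ⟨φ', h1, h2, h3⟩ := exists_lift G F 0 (by simpa using hφ) hφ'
    obtain ⟨ψ', h1', h2', h3'⟩ := exists_lift F G 0 (by simpa using hψ) hψ'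
    simp only [add_zero] at h1 h1'
    -- `A q * (ψ' * φ' - 1) = (ψ * φ - 1) * A q = A q * h * A q`. By exactness the difference `ψ' *
    -- φ' - 1 - h * A q` therefore factors through the next differential, which gives the next
    -- homotopy.
    have key : F.A q * (ψ' * φ' - 1 - h * F.A q) = 0 := by
      rw [Matrix.mul_sub, Matrix.mul_sub, ← Matrix.mul_assoc, h2', Matrix.mul_assoc, h2,
        ← Matrix.mul_assoc, ← Matrix.mul_assoc (F.A q), ← hh, Matrix.sub_mul, Matrix.mul_one,
        Matrix.one_mul, sub_self]
    have : ∀ b, ∃ y, (F.A (q + 1)).mulVec y =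
        (ψ' * φ' - 1 - h * F.A q).mulVec (Pi.single b 1) := fun b => by
      rw [← F.exact_succ, Matrix.mulVec_mulVec, key, Matrix.zero_mulVec]
    choose H hH using this
    have hHm : F.A (q + 1) * (Matrix.of fun c b => H b c) = ψ' * φ' - 1 - h * F.A q := by
      refine Matrix.ext_of_mulVec_single fun b => ?_
      rw [← hH b, ← Matrix.mulVec_mulVec]
      congr 1
      ext c : 1
      simp
    rw [eq_sub_iff_add_eq] at hHm
    refine ⟨φ', ψ', Matrix.of fun c b => H b c, h1, h1', h3, h3', ?_, ?_⟩
    · rw [← hHm, Matrix.add_mul, Matrix.mul_assoc h, F.A_mul_A, Matrix.mul_zero, add_zero]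
    · intro c b
      rw [← hHm, Matrix.add_apply, map_add, minimal_mul, mul_minimal, add_zero]

/-- Modulo the irrelevant ideal, `ψ * φ` is the identity. A homogeneous matrix has nonzero constant
terms only between basis vectors of equal degree, so the degree `j` blocks of constant terms already
satisfy `a' * a = 1` over `k`, and comparing ranks gives the inequality. -/
theorem betti_le (hI : IsGraded I) (F G : Resolution I) (q : ℕ) (j : ℤ) :
    F.betti q j ≤ G.betti q j := by
  obtain ⟨φ, ψ, -, hφ, hψ, -, -, -, hmin⟩ := exists_comparison hI F G q
  let a : Matrix {c // G.deg q c = j} {b // F.deg q b = j} k := fun c b => constantCoeff (φ c b)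
  let a' : Matrix {b // F.deg q b = j} {c // G.deg q c = j} k := fun b c => constantCoeff (ψ b c)
  have h1 : a' * a = 1 := by
    ext b b'
    have h2 := hmin b b'
    rw [Matrix.sub_apply, map_sub, sub_eq_zero, Matrix.mul_apply, map_sum] at h2
    have h3 : constantCoeff ((1 : Matrix (F.ι q) (F.ι q) (MvPolynomial σ k)) b b') =
        (1 : Matrix {b // F.deg q b = j} {b // F.deg q b = j} k) b b' := by
      simp only [Matrix.one_apply, Subtype.ext_iff]
      split_ifs <;> simp
    rw [← h3, ← h2, Matrix.mul_apply, ← Fintype.sum_subtype_add_sum_subtype (G.deg q · = j)]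
    simp only [a, a', map_mul]
    rw [left_eq_add]
    refine Finset.sum_eq_zero fun c _ => ?_
    rw [constantCoeff_eq_zero_of_mem _ (hφ c b'), mul_zero]
    rw [b'.2, sub_ne_zero]
    exact Ne.symm c.2
  have h2 := (Matrix.rank_mul_le_left a' a).trans (Matrix.rank_le_card_width a')
  rwa [h1, Matrix.rank_one, Fintype.card_subtype, Fintype.card_subtype] at h2

theorem betti_eq (hI : IsGraded I) (F G : Resolution I) (q : ℕ) (j : ℤ) :
    F.betti q j = G.betti q j :=
  le_antisymm (betti_le hI F G q j) (betti_le hI G F q j)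

end Resolution

/-! ### Mapping cones. -/

namespace Resolution

variable {σ k : Type*} [Field k] {I J : Ideal (MvPolynomial σ k)}

/-- Multiplication by a form `m` with `I : m = J` lifts to a map from a resolution of `R/J` to a
resolution of `R/I`. -/
theorem exists_mul_lift (hI : IsGraded I) {m : MvPolynomial σ k} {d : ℤ}
    (hm : m ∈ gradedPiece σ k d) (hJ : ∀ f, f ∈ J ↔ m * f ∈ I) (F : Resolution I)
    (G : Resolution J) :
    ∃ α : ∀ q, Matrix (F.ι q) (G.ι q) (MvPolynomial σ k),
      (∀ q, IsHomogMatrix (fun b => G.deg q b + d) (F.deg q) (α q)) ∧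
      (∀ q, F.A q * α (q + 1) = α q * G.A q) ∧
      ∀ x, F.u ⬝ᵥ (α 0).mulVec x - m * (G.u ⬝ᵥ x) ∈ I := by
  obtain ⟨α₀, h1, h2⟩ := hI.exists_dotProduct_sub_mem (y := fun b => m * G.u b)
    (w := fun b => G.deg 0 b + d) F.homog_u
    (fun b => add_comm d (G.deg 0 b) ▸ mul_mem_gradedPiece hm (G.homog_u b)) fun b => F.surj _
  have h3 : ∀ x, F.u ⬝ᵥ α₀.mulVec x - m * (G.u ⬝ᵥ x) ∈ I := by
    intro x
    have : m * (G.u ⬝ᵥ x) = (fun b => m * G.u b) ⬝ᵥ x := by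
      rw [← smul_eq_mul, ← smul_dotProduct]
      rfl
    rw [this, Matrix.dotProduct_mulVec, ← sub_dotProduct]
    exact Ideal.sum_mem _ fun c _ => Ideal.mul_mem_right _ _ (h2 c)
  let T (q : ℕ) := {φ : Matrix (F.ι q) (G.ι q) (MvPolynomial σ k) //
    IsHomogMatrix (fun b => G.deg q b + d) (F.deg q) φ ∧
    ∀ x, ∃ y, (F.A q).mulVec y = φ.mulVec ((G.A q).mulVec x)}
  have step : ∀ q (φ : T q), ∃ φ' : T (q + 1), F.A q * φ'.1 = φ.1 * G.A q := by
    intro q φ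
    obtain ⟨φ', h, h', h''⟩ := exists_lift F G d φ.2.1 φ.2.2
    exact ⟨⟨φ', h, h''⟩, h'⟩
  choose f hf using step
  let α : ∀ q, T q := fun q => Nat.rec ⟨α₀, h1, fun x => by
    rw [← F.exact_zero]
    have := Ideal.add_mem _ (h3 ((G.A 0).mulVec x)) ((hJ _).1 (G.dotProduct_mulVec_mem x))
    rwa [sub_add_cancel] at this⟩ f q
  exact ⟨fun q => (α q).1, fun q => (α q).2.1, fun q => hf q (α q), h3⟩

/-- The index types of the mapping cone. -/
abbrev coneIndex (F : Resolution I) (G : Resolution J) : ℕ → Type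
  | 0 => F.ι 0
  | q + 1 => F.ι (q + 1) ⊕ G.ι q

/-- The exactness computation common to all spots of the cone. The condition that `g` is a boundary
is kept separate, because its source differs: in the lowest spot it comes from `J = I : m`, higher
up from exactness of `G`. -/
theorem exact_cone_block (F : Resolution I) (G : Resolution J)
    {α : ∀ q, Matrix (F.ι q) (G.ι q) (MvPolynomial σ k)}
    (hα : ∀ q, F.A q * α (q + 1) = α q * G.A q) (q : ℕ) (f : F.ι (q + 1) → MvPolynomial σ k)
    (g : G.ι q → MvPolynomial σ k) :
    ((F.A q).mulVec f + (α q).mulVec g = 0 ∧ ∃ g', (G.A q).mulVec g' = g) ↔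
      ∃ y, (Matrix.fromBlocks (F.A (q + 1)) (α (q + 1)) 0 (-G.A q)).mulVec y = Sum.elim f g := by
  constructor
  · rintro ⟨h, g', rfl⟩
    rw [Matrix.mulVec_mulVec, ← hα, ← Matrix.mulVec_mulVec, ← Matrix.mulVec_add,
      F.exact_succ] at h
    obtain ⟨f', hf'⟩ := h
    refine ⟨Sum.elim f' (-g'), ?_⟩
    rw [Matrix.fromBlocks_mulVec]
    simp only [Sum.elim_comp_inl, Sum.elim_comp_inr, Matrix.mulVec_neg, Matrix.neg_mulVec,
      Matrix.zero_mulVec, zero_add, neg_neg, hf', add_neg_cancel_right]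
  · rintro ⟨y, hy⟩
    rw [Matrix.fromBlocks_mulVec] at hy
    have h1 := congrArg (fun z => z ∘ Sum.inl) hy
    have h2 := congrArg (fun z => z ∘ Sum.inr) hy
    simp only [Sum.elim_comp_inl, Sum.elim_comp_inr, Matrix.zero_mulVec, zero_add] at h1 h2
    refine ⟨?_, -(y ∘ Sum.inr), by rw [← h2, Matrix.mulVec_neg, Matrix.neg_mulVec]⟩
    rw [← h1, ← h2, Matrix.mulVec_add, Matrix.mulVec_mulVec, F.A_mul_A, Matrix.zero_mulVec,
      zero_add, Matrix.mulVec_mulVec, hα, Matrix.neg_mulVec, Matrix.mulVec_neg,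
      Matrix.mulVec_mulVec, add_neg_cancel]

/-- The mapping cone of multiplication by a form `m` of degree `d` is a minimal resolution, provided
the degrees of the basis vectors are large enough. -/
theorem exists_cone (hI : IsGraded I) {m : MvPolynomial σ k} {d : ℤ}
    (hm : m ∈ gradedPiece σ k d) (hJ : ∀ f, f ∈ J ↔ m * f ∈ I) (F : Resolution I)
    (G : Resolution J) (hdeg : ∀ q b c, F.deg q b < G.deg q c + d) :
    ∃ C : Resolution (I ⊔ Ideal.span {m}), (∀ j, C.betti 0 j = F.betti 0 j) ∧
      ∀ q j, C.betti (q + 1) j = F.betti (q + 1) j + G.betti q (j - d) := by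
  obtain ⟨α, hα, hα', hu⟩ := exists_mul_lift hI hm hJ F G
  have hα0 : ∀ q c b, constantCoeff (α q c b) = 0 := fun q c b =>
    constantCoeff_eq_zero_of_mem (by have := hdeg q c b; dsimp only; omega) (hα q c b)
  let inst (q : ℕ) : Fintype (coneIndex F G q) := match q with
    | 0 => F.fin 0
    | q + 1 => @instFintypeSum _ _ (F.fin (q + 1)) (G.fin q)
  let A : ∀ q, Matrix (coneIndex F G q) (coneIndex F G (q + 1)) (MvPolynomial σ k)
    | 0 => Matrix.fromCols (F.A 0) (α 0)
    | q + 1 => Matrix.fromBlocks (F.A (q + 1)) (α (q + 1)) 0 (-G.A q)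
  let deg : ∀ q, coneIndex F G q → ℤ
    | 0 => F.deg 0
    | q + 1 => Sum.elim (F.deg (q + 1)) fun b => G.deg q b + d
  refine ⟨{
    ι := coneIndex F G
    fin := inst
    dec := fun q => match q with
      | 0 => F.dec 0
      | q + 1 => @instDecidableEqSum _ _ (F.dec (q + 1)) (G.dec q)
    deg := deg
    A := A
    u := F.u
    homog := ?_
    homog_u := F.homog_u
    surj := fun y => (F.surj y).imp fun x hx => Ideal.mem_sup_left hx
    exact_zero := ?_
    exact_succ := ?_
    minimal := ?_ }, fun j => rfl, fun q j => ?_⟩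
  · rintro (_ | q) c (b | b)
    · exact F.homog 0 c b
    · exact hα 0 c b
    · rcases c with c | c
      · exact F.homog (q + 1) c b
      · exact Submodule.zero_mem _
    · rcases c with c | c
      · exact hα (q + 1) c b
      · exact Submodule.neg_mem _ ((G.homog q).add_const d c b)
  · intro x
    change _ ↔ ∃ y : F.ι 1 ⊕ G.ι 0 → _, (Matrix.fromCols (F.A 0) (α 0)).mulVec y = x
    rw [sup_comm, Ideal.mem_span_singleton_sup]
    constructor
    -- Here `u ⬝ᵥ x = a * m + b` with `b ∈ I`. Subtracting from `x` the image under `α 0` of a lift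
    -- `g` of `a` leaves a vector that maps into `I`.
    · rintro ⟨a, b, hb, hab⟩
      obtain ⟨g, hg⟩ := G.surj a
      have h1 : F.u ⬝ᵥ (x - (α 0).mulVec g) ∈ I := by
        have := Ideal.sub_mem _ (Ideal.sub_mem _ hb (hu g)) ((hJ _).1 hg)
        rw [dotProduct_sub, ← hab]
        convert this using 1
        ring
      obtain ⟨f, hf⟩ := (F.exact_zero _).1 h1
      refine ⟨Sum.elim f g, ?_⟩
      rw [Matrix.fromCols_mulVec, Sum.elim_comp_inl, Sum.elim_comp_inr, hf, sub_add_cancel]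
    · rintro ⟨y, rfl⟩
      have h1 := Ideal.add_mem _ (hu (y ∘ Sum.inr)) (F.dotProduct_mulVec_mem (y ∘ Sum.inl))
      refine ⟨G.u ⬝ᵥ (y ∘ Sum.inr), _, h1, ?_⟩
      rw [Matrix.fromCols_mulVec, dotProduct_add]
      ring
  · rintro (_ | q) x
    · change (Matrix.fromCols (F.A 0) (α 0)).mulVec x = 0 ↔
        ∃ y, (Matrix.fromBlocks (F.A 1) (α 1) 0 (-G.A 0)).mulVec y = x
      have h := exact_cone_block F G hα' 0 (x ∘ Sum.inl) (x ∘ Sum.inr)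
      rw [Sum.elim_comp_inl_inr] at h
      rw [← h, Matrix.fromCols_mulVec]
      -- The second condition is automatic: `h0` puts `m * (G.u ⬝ᵥ g)` in `I`, so `G.u ⬝ᵥ g` lies in
      -- `I : m = J`.
      refine ⟨fun h0 => ⟨h0, ?_⟩, And.left⟩
      rw [← G.exact_zero, hJ]
      have h1 := hu (x ∘ Sum.inr)
      rw [eq_neg_of_add_eq_zero_right h0, dotProduct_neg] at h1
      have := Ideal.add_mem _ h1 (F.dotProduct_mulVec_mem (x ∘ Sum.inl))
      rw [← Ideal.neg_mem_iff]
      convert this using 1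
      ring
    · change (Matrix.fromBlocks (F.A (q + 1)) (α (q + 1)) 0 (-G.A q)).mulVec x = 0 ↔
        ∃ y, (Matrix.fromBlocks (F.A (q + 2)) (α (q + 2)) 0 (-G.A (q + 1))).mulVec y = x
      have h := exact_cone_block F G hα' (q + 1) (x ∘ Sum.inl) (x ∘ Sum.inr)
      rw [Sum.elim_comp_inl_inr] at h
      rw [← h, Matrix.fromBlocks_mulVec, ← G.exact_succ, _root_.funext_iff, Sum.forall,
        _root_.funext_iff, _root_.funext_iff]
      simp [Matrix.neg_mulVec]
  · rintro (_ | q) c (b | b)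
    · exact F.minimal 0 c b
    · exact hα0 0 c b
    · rcases c with c | c
      · exact F.minimal (q + 1) c b
      · exact map_zero _
    · rcases c with c | c
      · exact hα0 (q + 1) c b
      · exact (map_neg _ _).trans (by rw [G.minimal, neg_zero])
  · change (Finset.univ.filter fun b : F.ι (q + 1) ⊕ G.ι q =>
      Sum.elim (F.deg (q + 1)) (fun b => G.deg q b + d) b = j).card = _
    rw [← Fintype.card_subtype, Fintype.card_congr (Equiv.subtypeSum), Fintype.card_sum,
      Fintype.card_subtype, Fintype.card_subtype]
    simp only [Sum.elim_inl, Sum.elim_inr, ← eq_sub_iff_add_eq]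
    rfl

end Resolution

/-! ### Transport along automorphisms, and passage between matrices and linear maps. -/

namespace Resolution

variable {σ k : Type*} [Field k] {I J : Ideal (MvPolynomial σ k)}

/-- The image of a resolution under a graded automorphism of the polynomial ring. -/
noncomputable def mapEquiv (F : Resolution I) (φ : MvPolynomial σ k ≃ₐ[k] MvPolynomial σ k)
    (hφ : ∀ j f, f ∈ gradedPiece σ k j → φ f ∈ gradedPiece σ k j) (hJ : ∀ f, φ f ∈ J ↔ f ∈ I) :
    Resolution J :=
  have hsurj : ∀ ι : Type, Function.Surjective fun x : ι → MvPolynomial σ k => φ ∘ x :=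
    fun _ => φ.surjective.comp_left
  have hinj : ∀ {ι : Type} (x y : ι → MvPolynomial σ k), φ ∘ x = φ ∘ y ↔ x = y :=
    fun _ _ => φ.injective.comp_left.eq_iff
  have hmul : ∀ {ι κ : Type} [Fintype κ] (A : Matrix ι κ (MvPolynomial σ k)) x,
      (A.map φ).mulVec (φ ∘ x) = φ ∘ A.mulVec x := fun A x => by
    ext i : 1
    exact (RingHom.map_mulVec (φ : MvPolynomial σ k →+* MvPolynomial σ k) A x i).symm
  have hdot : ∀ x, (φ ∘ F.u) ⬝ᵥ (φ ∘ x) = φ (F.u ⬝ᵥ x) := fun x =>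
    (RingHom.map_dotProduct (φ : MvPolynomial σ k →+* MvPolynomial σ k) _ _).symm
  { ι := F.ι
    fin := F.fin
    dec := F.dec
    deg := F.deg
    A := fun q => (F.A q).map φ
    u := φ ∘ F.u
    homog := fun q c b => hφ _ _ (F.homog q c b)
    homog_u := fun b => hφ _ _ (F.homog_u b)
    surj := fun y => by
      obtain ⟨y, rfl⟩ := φ.surjective y
      obtain ⟨x, hx⟩ := F.surj y
      refine ⟨φ ∘ x, ?_⟩
      rwa [hdot, ← map_sub, hJ]
    exact_zero := fun x => by
      obtain ⟨x, rfl⟩ := hsurj _ x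
      rw [(hsurj _).exists]
      simp only [hdot, hJ, hmul, hinj, F.exact_zero]
    exact_succ := fun q x => by
      obtain ⟨x, rfl⟩ := hsurj _ x
      have h0 : (0 : F.ι q → MvPolynomial σ k) = φ ∘ (0 : F.ι q → MvPolynomial σ k) := by
        ext b : 1
        exact (map_zero φ).symm
      rw [hmul, h0, (hsurj _).exists]
      simp only [hmul, hinj, F.exact_succ]
    minimal := fun q c b => by
      have h1 : irrelevantIdeal σ k ≤ (irrelevantIdeal σ k).comap φ := by
        refine Ideal.span_le.2 ?_
        rintro _ ⟨i, rfl⟩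
        exact mem_irrelevantIdeal.2 (constantCoeff_eq_zero_of_mem one_ne_zero
          (hφ 1 _ (isHomogeneous_X k i)))
      exact mem_irrelevantIdeal.1 (h1 (mem_irrelevantIdeal.2 (F.minimal q c b))) }

theorem mem_smul_top_iff {ι : Type*} [Fintype ι] {𝔪 : Ideal (MvPolynomial σ k)}
    {x : ι → MvPolynomial σ k} :
    x ∈ 𝔪 • (⊤ : Submodule (MvPolynomial σ k) (ι → MvPolynomial σ k)) ↔ ∀ c, x c ∈ 𝔪 := by
  classical
  constructor
  · intro h c
    refine Submodule.smul_induction_on h (fun r hr n _ => ?_) (fun x y hx hy => ?_)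
    · exact Ideal.mul_mem_right _ _ hr
    · exact Ideal.add_mem _ hx hy
  · intro h
    rw [pi_eq_sum_univ' x]
    exact Submodule.sum_mem _ fun c _ => Submodule.smul_mem_smul (h c) trivial

/-- A resolution in matrix form gives one by linear maps. -/
noncomputable def toMinimal (F : Resolution I) :
    MinimalGradedFreeResolution (σ := σ) (quotientPiece I) :=
  let e (q : ℕ) := (Fintype.equivFin (F.ι q)).symm
  have hmul : ∀ q x, ((F.A q).submatrix (e q) (e (q + 1))).mulVec (x ∘ e (q + 1)) =
      (F.A q).mulVec x ∘ e q := fun q x => by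
    rw [Matrix.submatrix_mulVec_equiv, Function.comp_assoc, Equiv.self_comp_symm,
      Function.comp_id]
  have hε : ∀ x, (Submodule.mkQ I) (Fintype.linearCombination (MvPolynomial σ k) (F.u ∘ e 0)
      (x ∘ e 0)) = Submodule.mkQ I (F.u ⬝ᵥ x) := fun x => by
    rw [Fintype.linearCombination_apply, dotProduct,
      ← (e 0).sum_comp]
    simp only [Function.comp_apply, smul_eq_mul, mul_comm]
  have hsurj : ∀ q, Function.Surjective fun x : F.ι q → MvPolynomial σ k => x ∘ e q :=
    fun q => (e q).injective.surjective_comp_right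
  have hinj : ∀ q, Function.Injective fun x : F.ι q → MvPolynomial σ k => x ∘ e q :=
    fun q => (e q).surjective.injective_comp_right
  { rank := fun q => Fintype.card (F.ι q)
    shift := fun q b => F.deg q (e q b)
    d := fun q => Matrix.toLin' ((F.A q).submatrix (e q) (e (q + 1)))
    ε := (Submodule.mkQ I).comp (Fintype.linearCombination (MvPolynomial σ k) (F.u ∘ e 0))
    d_homogeneous := fun q b c => by
      rw [Matrix.toLin'_apply, Matrix.mulVec_single_one]
      exact F.homog q _ _
    ε_homogeneous := fun b => by
      refine ⟨F.u (e 0 b), F.homog_u _, ?_⟩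
      rw [LinearMap.comp_apply, Fintype.linearCombination_apply_single, one_smul]
      rfl
    ε_surjective := fun y => by
      obtain ⟨y, rfl⟩ := Submodule.mkQ_surjective I y
      obtain ⟨x, hx⟩ := F.surj y
      exact ⟨x ∘ e 0, (hε x).trans ((Submodule.Quotient.eq I).2 hx)⟩
    exact_zero := fun x => by
      obtain ⟨x, rfl⟩ := hsurj 0 x
      rw [LinearMap.comp_apply, hε, Submodule.mkQ_apply, Submodule.Quotient.mk_eq_zero,
        F.exact_zero]
      simp only [Set.mem_range, (hsurj 1).exists, Matrix.toLin'_apply, hmul, (hinj 0).eq_iff]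
    exact_succ := fun q x => by
      obtain ⟨x, rfl⟩ := hsurj (q + 1) x
      have h0 : (0 : Fin (Fintype.card (F.ι q)) → MvPolynomial σ k) =
        (0 : F.ι q → MvPolynomial σ k) ∘ e q := rfl
      rw [Matrix.toLin'_apply, hmul, h0, (hinj q).eq_iff, F.exact_succ]
      simp only [Set.mem_range, (hsurj (q + 2)).exists, Matrix.toLin'_apply, hmul,
        (hinj (q + 1)).eq_iff]
    minimal := fun q => by
      rintro _ ⟨x, rfl⟩
      obtain ⟨x, rfl⟩ := hsurj (q + 1) x
      rw [Matrix.toLin'_apply, hmul, mem_smul_top_iff]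
      exact fun c => Ideal.sum_mem _ fun b _ =>
        Ideal.mul_mem_right _ _ (mem_irrelevantIdeal.2 (F.minimal q _ b)) }

theorem betti_deg_ne_zero (F : Resolution I) {q : ℕ} (b : F.ι q) : F.betti q (F.deg q b) ≠ 0 :=
  Finset.card_ne_zero_of_mem (Finset.mem_filter.2 ⟨Finset.mem_univ b, rfl⟩)

/-- Makes the uniqueness of Betti numbers available for an arbitrary resolution: homogeneous lifts
to `R` of the images of the basis vectors of `F_0` supply `u`. -/
theorem exists_of_minimal (F : MinimalGradedFreeResolution (σ := σ) (quotientPiece I)) :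
    ∃ F' : Resolution I, ∀ q j, F'.betti q j = F.betti q j := by
  choose u hu hu' using F.ε_homogeneous
  have hε : ∀ x, F.ε x = Submodule.mkQ I (u ⬝ᵥ x) := by
    intro x
    conv_lhs => rw [pi_eq_sum_univ' x]
    rw [dotProduct, map_sum, map_sum]
    refine Finset.sum_congr rfl fun b _ => ?_
    rw [mul_comm, ← smul_eq_mul, map_smul, map_smul]
    congr 1
    exact (hu' b).symm
  refine ⟨{
    ι := fun q => Fin (F.rank q)
    fin := inferInstance
    dec := inferInstance
    deg := F.shift
    A := fun q => LinearMap.toMatrix' (F.d q)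
    u := u
    homog := fun q c b => by
      rw [LinearMap.toMatrix'_apply]
      exact F.d_homogeneous q b c
    homog_u := hu
    surj := fun y => by
      obtain ⟨x, hx⟩ := F.ε_surjective (Submodule.mkQ I y)
      exact ⟨x, (Submodule.Quotient.eq I).1 ((hε x).symm.trans hx)⟩
    exact_zero := fun x => by
      simp only [LinearMap.toMatrix'_mulVec]
      rw [← Submodule.Quotient.mk_eq_zero I, ← Submodule.mkQ_apply, ← hε]
      exact F.exact_zero x
    exact_succ := fun q x => by
      simp only [LinearMap.toMatrix'_mulVec]
      exact F.exact_succ q x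
    minimal := fun q c b => by
      rw [LinearMap.toMatrix'_apply, ← mem_irrelevantIdeal]
      exact mem_smul_top_iff.1 (F.minimal q ⟨_, rfl⟩) c }, fun q j => rfl⟩

end Resolution

/-! ### Betti tables of ideals. -/

/-- The ideal `I` is graded and `R/I` has a minimal graded free resolution with
`F_0 = R` and with Betti numbers `β_{q+1,j} = c q j`. -/
def HasBetti {σ k : Type*} [Field k] (I : Ideal (MvPolynomial σ k)) (c : ℕ → ℤ → ℕ) : Prop :=
  IsGraded I ∧ ∃ F : Resolution I, (∀ j, F.betti 0 j = if j = 0 then 1 else 0) ∧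
    ∀ q j, F.betti (q + 1) j = c q j

namespace HasBetti

variable {σ k : Type*} [Field k] {I J : Ideal (MvPolynomial σ k)} {c c' : ℕ → ℤ → ℕ}

theorem minimalGradedFreeResolution (h : HasBetti I c) :
    Nonempty (MinimalGradedFreeResolution (σ := σ) (quotientPiece I)) ∧
    ∀ F : MinimalGradedFreeResolution (σ := σ) (quotientPiece I),
      (∀ j, F.betti 0 j = if j = 0 then 1 else 0) ∧ ∀ q j, F.betti (q + 1) j = c q j := by
  obtain ⟨hI, F, h0, h1⟩ := h
  refine ⟨⟨F.toMinimal⟩, fun G => ?_⟩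
  obtain ⟨G', hG⟩ := Resolution.exists_of_minimal G
  simp only [← hG, G'.betti_eq hI F, h0, h1, implies_true, and_self]

theorem mapEquiv (h : HasBetti I c) (φ : MvPolynomial σ k ≃ₐ[k] MvPolynomial σ k)
    (hφ : ∀ j f, f ∈ gradedPiece σ k j → φ f ∈ gradedPiece σ k j) (hJ : ∀ f, φ f ∈ J ↔ f ∈ I)
    (hJ' : IsGraded J) :
    HasBetti J c :=
  ⟨hJ', h.2.choose.mapEquiv φ hφ hJ, h.2.choose_spec⟩

theorem congr (h : HasBetti I c) (hI : I = J) (hc : ∀ q j, c q j = c' q j) : HasBetti J c' := by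
  obtain rfl : c = c' := _root_.funext fun q => _root_.funext (hc q)
  exact hI ▸ h

theorem bot : HasBetti (⊥ : Ideal (MvPolynomial σ k)) fun _ _ => 0 := by
  have hdot : ∀ x : {_a : Unit // 0 = 0} → MvPolynomial σ k,
      (fun _ => (1 : MvPolynomial σ k)) ⬝ᵥ x = x ⟨(), rfl⟩ := fun x => by
    rw [dotProduct, Fintype.sum_subsingleton _ ⟨(), rfl⟩, one_mul]
  have hempty : ∀ q : ℕ, IsEmpty {_a : Unit // q + 1 = 0} := fun q => ⟨fun a => by simpa using a.2⟩
  refine ⟨fun f hf j => ?_, {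
    -- One basis vector in homological degree zero and none above, written uniformly in `q`.
    ι := fun q => {_a : Unit // q = 0}
    fin := inferInstance
    dec := inferInstance
    deg := fun _ _ => 0
    A := fun _ _ _ => 0
    u := fun _ => 1
    homog := fun q c b => Submodule.zero_mem _
    homog_u := fun _ => one_mem_gradedPiece
    surj := fun y => ⟨fun _ => y, by rw [hdot, sub_self]; exact Ideal.zero_mem _⟩
    exact_zero := fun x => ?_
    exact_succ := fun q x => ?_
    minimal := fun q c b => map_zero _ }, fun j => ?_, fun q j => ?_⟩
  · rw [Ideal.mem_bot] at hf
    rw [hf, map_zero]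
    exact Ideal.zero_mem _
  · rw [hdot, Ideal.mem_bot]
    have h0 : ∀ y, Matrix.mulVec (fun _ _ => 0 : Matrix {_a : Unit // 0 = 0} {_a : Unit // 1 = 0}
      (MvPolynomial σ k)) y = 0 := Matrix.zero_mulVec
    simp only [h0, exists_const, _root_.funext_iff, Subtype.forall, Pi.zero_apply]
    exact ⟨fun h _ _ => h.symm, fun h => (h () trivial).symm⟩
  · have := hempty q
    exact ⟨fun _ => ⟨0, Subsingleton.elim _ _⟩, fun _ => by
      ext a : 1
      simp [Matrix.mulVec, dotProduct]⟩
  · simp only [Resolution.betti, eq_comm (a := (0 : ℤ))]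
    split_ifs with h <;> simp [h]
  · have := hempty q
    simp [Resolution.betti]

/-- The Betti numbers of `R/(I + m)` from those of `R/I` and `R/(I : m)`. -/
theorem sup_span_singleton (h : HasBetti I c) (h' : HasBetti J c') {m : MvPolynomial σ k} {d : ℤ}
    (hm : m ∈ gradedPiece σ k d) (hJ : ∀ f, f ∈ J ↔ m * f ∈ I)
    (hI' : IsGraded (I ⊔ Ideal.span {m})) (hd : 0 < d)
    (hc : ∀ q j, c q j ≠ 0 → j ≤ q + d) (hc' : ∀ q j, c' q j ≠ 0 → j = q + 1) :
    HasBetti (I ⊔ Ideal.span {m}) fun q j => c q j +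
      match q with
      | 0 => if j = d then 1 else 0
      | q + 1 => c' q (j - d) := by
  obtain ⟨hI, F, h0, h1⟩ := h
  obtain ⟨hI', G, h0', h1'⟩ := h'
  -- Minimality of the cone is a degree count. In homological degree `q + 1`, vectors of `F` have
  -- degree at most `q + d`, and those of `G`, shifted by `d`, have degree `q + 1 + d`. In
  -- homological degree zero the comparison is `0 < d`.
  obtain ⟨C, hC, hC'⟩ := Resolution.exists_cone hI hm hJ F G fun q b b' => by
    have h1 := F.betti_deg_ne_zero b
    have h2 := G.betti_deg_ne_zero b'
    rcases q with _ | q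
    · rw [h0, ite_ne_right_iff] at h1
      rw [h0', ite_ne_right_iff] at h2
      omega
    · have h3 := hc _ _ (‹∀ q j, F.betti (q + 1) j = c q j› _ _ ▸ h1)
      have h4 := hc' _ _ (h1' _ _ ▸ h2)
      omega
  refine ⟨‹_›, C, fun j => by rw [hC, h0], ?_⟩
  rintro (_ | q) j
  · rw [hC', h1, h0']
    simp only [sub_eq_zero]
  · rw [hC', h1, h1']

end HasBetti

/-! ### Monomial ideals, the Koszul complex and linear quotients. -/

section Monomial

variable {σ k : Type*} [Field k]

variable (k) in
/-- The ideal generated by a set of monomials. -/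
noncomputable def monomialIdeal (A : Set (σ →₀ ℕ)) : Ideal (MvPolynomial σ k) :=
  Ideal.span ((fun a => monomial a 1) '' A)

theorem mem_monomialIdeal {A : Set (σ →₀ ℕ)} {f : MvPolynomial σ k} :
    f ∈ monomialIdeal k A ↔ ∀ c, coeff c f ≠ 0 → ∃ a ∈ A, a ≤ c := by
  simp only [monomialIdeal, mem_ideal_span_monomial_image, mem_support_iff]

theorem isGraded_monomialIdeal (A : Set (σ →₀ ℕ)) : IsGraded (monomialIdeal k A) := by
  intro f hf j
  rw [mem_monomialIdeal] at hf ⊢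
  intro c hc
  refine hf c fun h => hc ?_
  rw [coeff_gradedComponent, h, ite_self]

theorem monomialIdeal_insert (m : σ →₀ ℕ) (A : Set (σ →₀ ℕ)) :
    monomialIdeal k A ⊔ Ideal.span {monomial m 1} = monomialIdeal k (insert m A) := by
  rw [monomialIdeal, monomialIdeal, Set.image_insert_eq, Ideal.span_insert, sup_comm]

theorem monomialIdeal_eq_of_forall {A B : Set (σ →₀ ℕ)}
    (h : ∀ c, (∃ a ∈ A, a ≤ c) ↔ ∃ b ∈ B, b ≤ c) : monomialIdeal k A = monomialIdeal k B := by
  ext f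
  simp only [mem_monomialIdeal, h]

theorem mem_monomialIdeal_iff_mul_mem {A B : Set (σ →₀ ℕ)} {m : σ →₀ ℕ}
    (h : ∀ c, (∃ b ∈ B, b ≤ c) ↔ ∃ a ∈ A, a ≤ m + c) (f : MvPolynomial σ k) :
    f ∈ monomialIdeal k B ↔ monomial m 1 * f ∈ monomialIdeal k A := by
  simp only [mem_monomialIdeal, h]
  constructor
  · intro hf c hc
    rw [coeff_monomial_mul', one_mul, ite_ne_right_iff] at hc
    obtain ⟨a, ha, hac⟩ := hf _ hc.2
    exact ⟨a, ha, by rwa [add_tsub_cancel_of_le hc.1] at hac⟩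
  · intro hf c hc
    exact hf (m + c) (by rwa [coeff_monomial_mul, one_mul])

theorem monomial_mem_gradedPiece (m : σ →₀ ℕ) :
    (monomial m 1 : MvPolynomial σ k) ∈ gradedPiece σ k m.degree :=
  isHomogeneous_monomial 1 rfl

theorem exists_single_le_iff {V : Set σ} {c : σ →₀ ℕ} :
    (∃ b ∈ (fun v => Finsupp.single v 1) '' V, b ≤ c) ↔ ∃ v ∈ V, c v ≠ 0 := by
  simp [Finsupp.single_le_iff, Nat.one_le_iff_ne_zero]

/-- The Koszul complex on a set of variables. -/
theorem hasBetti_variables (V : Finset σ) :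
    HasBetti (monomialIdeal k ((fun v => Finsupp.single v 1) '' (V : Set σ))) fun q j =>
      if j = q + 1 then V.card.choose (q + 1) else 0 := by
  classical
  induction V using Finset.induction_on with
  | empty =>
    refine HasBetti.bot.congr ?_ fun q j => by simp
    simp [monomialIdeal]
  | insert v V hv ih =>
    -- A new variable is a nonzerodivisor modulo the old ones, so the colon ideal is the ideal
    -- itself and `ih` serves for both terms of the cone.
    have h := ih.sup_span_singleton ih (m := monomial (Finsupp.single v 1) 1) (d := 1)
      (by simpa using monomial_mem_gradedPiece (k := k) (Finsupp.single v 1))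
      (mem_monomialIdeal_iff_mul_mem fun c => by
        rw [exists_single_le_iff, exists_single_le_iff]
        refine exists_congr fun w => and_congr_right fun hw => ?_
        have : v ≠ w := fun h => hv (h ▸ hw)
        rw [Finsupp.add_apply, Finsupp.single_eq_of_ne this.symm, zero_add])
      (by rw [monomialIdeal_insert]; exact isGraded_monomialIdeal _) one_pos
      (fun q j h => by rw [ite_ne_right_iff] at h; omega)
      (fun q j h => by rw [ite_ne_right_iff] at h; omega)
    refine h.congr (by rw [monomialIdeal_insert, Finset.coe_insert, Set.image_insert_eq]) ?_
    rintro (_ | q) j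
    · simp only [Finset.card_insert_of_notMem hv]
      split_ifs <;> simp_all
    · simp only [Finset.card_insert_of_notMem hv, sub_eq_iff_eq_add, Nat.cast_add, Nat.cast_one]
      split_ifs
      · rw [Nat.choose_succ_succ, add_comm]
      · rfl

/-- Linear quotients: adding monomials of degree `d` to a monomial ideal, one at a time, when each
colon ideal is generated by a set `V x` of variables. -/
theorem HasBetti.union_image {κ : Type*} [DecidableEq κ] {A : Set (σ →₀ ℕ)} {c : ℕ → ℤ → ℕ}
    (hA : HasBetti (monomialIdeal k A) c) (d : ℕ) (hd : 0 < d)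
    (hc : ∀ q j, c q j ≠ 0 → j ≤ q + d) (s : Finset κ) (mon : κ → σ →₀ ℕ) (ρ : κ → ℕ)
    (V : κ → Finset σ) (hdeg : ∀ x ∈ s, (mon x).degree = d)
    (hV : ∀ x ∈ s, ∀ v ∈ V x, (∃ a ∈ A, a ≤ mon x + Finsupp.single v 1) ∨
      ∃ y ∈ s, ρ y < ρ x ∧ mon y ≤ mon x + Finsupp.single v 1)
    (hbase : ∀ x ∈ s, ∀ a ∈ A, ∃ v ∈ V x, mon x v < a v)
    (hs : ∀ x ∈ s, ∀ y ∈ s, ρ y ≤ ρ x → y ≠ x → ∃ v ∈ V x, mon x v < mon y v) :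
    HasBetti (monomialIdeal k (A ∪ mon '' s)) fun q j =>
      c q j + if j = q + d then ∑ x ∈ s, (V x).card.choose q else 0 := by
  induction s using Finset.induction_on_max_value ρ with
  | empty => exact hA.congr (by simp) fun q j => by simp
  | insert z s hz hmax ih =>
    have ih := ih (fun x hx => hdeg x (Finset.mem_insert_of_mem hx))
      (fun x hx v hv => (hV x (Finset.mem_insert_of_mem hx) v hv).imp_right
        fun ⟨y, hy, hyx, h⟩ => ⟨y, by
          rcases Finset.mem_insert.1 hy with rfl | hy
          · exact absurd (hmax x hx) (not_le.2 hyx)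
          · exact hy, hyx, h⟩)
      (fun x hx => hbase x (Finset.mem_insert_of_mem hx))
      (fun x hx y hy => hs x (Finset.mem_insert_of_mem hx) y (Finset.mem_insert_of_mem hy))
    have hzm := Finset.mem_insert_self z s
    have h := ih.sup_span_singleton (hasBetti_variables (V z)) (m := monomial (mon z) 1) (d := d)
      (by rw [← hdeg z hzm]; exact monomial_mem_gradedPiece _)
      (mem_monomialIdeal_iff_mul_mem fun c => by
        rw [exists_single_le_iff]
        constructor
        · rintro ⟨v, hv, hcv⟩
          have hle : mon z + Finsupp.single v 1 ≤ mon z + c :=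
            add_le_add_right (Finsupp.single_le_iff.2 (Nat.one_le_iff_ne_zero.2 hcv)) _
          rcases hV z hzm v hv with ⟨a, ha, h⟩ | ⟨y, hy, hyz, h⟩
          · exact ⟨a, Or.inl ha, h.trans hle⟩
          · have hy : y ∈ s := (Finset.mem_insert.1 hy).resolve_left fun h => by
              subst h; exact lt_irrefl _ hyz
            exact ⟨_, Or.inr ⟨y, hy, rfl⟩, h.trans hle⟩
        · rintro ⟨a, ha, hac⟩
          obtain ⟨v, hv, h⟩ : ∃ v ∈ V z, mon z v < a v := by
            rcases ha with ha | ⟨y, hy, rfl⟩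
            · exact hbase z hzm a ha
            · exact hs z hzm y (Finset.mem_insert_of_mem hy) (hmax y hy)
                fun h => hz (h ▸ hy)
          have := hac v
          rw [Finsupp.add_apply] at this
          exact ⟨v, hv, by omega⟩)
      (by rw [monomialIdeal_insert]; exact isGraded_monomialIdeal _) (by exact_mod_cast hd)
      (fun q j h => by
        by_contra hj
        rw [if_neg (by omega), add_zero] at h
        exact hj (hc q j h))
      (fun q j h => by rw [ite_ne_right_iff] at h; exact h.1)
    refine h.congr ?_ ?_
    · rw [monomialIdeal_insert, Finset.coe_insert, Set.image_insert_eq, Set.union_insert]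
    · rintro (_ | q) j
      · simp only [Finset.sum_insert hz, Nat.cast_zero, zero_add, Nat.choose_zero_right]
        split_ifs <;> omega
      · simp only [Finset.sum_insert hz, sub_eq_iff_eq_add, Nat.cast_add, Nat.cast_one, add_assoc]
        split_ifs
        · ring
        · rfl

end Monomial

/-! ### Generators of degree three: the cube of an ideal of variables. -/

section TriplePoints

variable {σ k : Type*} [Field k]

/-- The exponent vector of the squarefree monomial with support `U`. -/
noncomputable def subsetExp (U : Finset σ) : σ →₀ ℕ :=
  ∑ u ∈ U, Finsupp.single u 1

theorem subsetExp_apply [DecidableEq σ] (U : Finset σ) (v : σ) :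
    subsetExp U v = if v ∈ U then 1 else 0 := by
  simp [subsetExp, Finsupp.finsetSum_apply, Finsupp.single_apply]

theorem degree_subsetExp (U : Finset σ) : (subsetExp U).degree = U.card := by
  simp [subsetExp]

theorem degree_eq_sum_of_support_subset {U : Finset σ} {a : σ →₀ ℕ} (ha : a.support ⊆ U) :
    a.degree = ∑ i ∈ U, a i :=
  Finset.sum_subset ha fun i _ hi => by simpa using hi

theorem degree_eq_sum_add_sum [DecidableEq σ] {S T : Finset σ} (hST : Disjoint S T) {a : σ →₀ ℕ}
    (ha : a.support ⊆ S ∪ T) : a.degree = ∑ i ∈ S, a i + ∑ i ∈ T, a i := by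
  rw [← Finset.sum_union hST, degree_eq_sum_of_support_subset ha]

/-- The cube of the ideal generated by a set of variables. -/
theorem hasBetti_cube [DecidableEq σ] (T : Finset σ) :
    HasBetti (monomialIdeal k {a : σ →₀ ℕ | a.support ⊆ T ∧ a.degree = 3}) fun q j =>
      if j = q + 3 then (T.card + 2).choose (q + 3) * (q + 2).choose q else 0 := by
  induction T using Finset.induction_on with
  | empty =>
    refine HasBetti.bot.congr ?_ fun q j => ?_
    · have : {a : σ →₀ ℕ | a.support ⊆ ∅ ∧ a.degree = 3} = ∅ := by
        ext a
        simp only [Finset.subset_empty, Finsupp.support_eq_empty, Set.mem_ofPred_eq,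
          Set.mem_empty_iff_false, iff_false, not_and]
        rintro rfl
        simp
      rw [monomialIdeal, this, Set.image_empty, Ideal.span_empty]
    · simp [Nat.choose_eq_zero_of_lt]
  | insert p T hp ih =>
    have hcard : ((Finset.finsuppAntidiag (insert p T) 3).filter fun a => a p ≠ 0).card =
        (T.card + 2).choose 2 := by
      have h1 := Finset.card_filter_add_card_filter_not (s := Finset.finsuppAntidiag (insert p T) 3)
        (fun a => a p ≠ 0)
      have h2 : ((Finset.finsuppAntidiag (insert p T) 3).filter fun a => ¬ a p ≠ 0) =
          Finset.finsuppAntidiag T 3 := by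
        ext a
        simp only [Finset.mem_filter, Finset.mem_finsuppAntidiag, Finset.sum_insert hp, not_not]
        constructor
        · rintro ⟨⟨h, h'⟩, h0⟩
          refine ⟨by rwa [h0, zero_add] at h, fun v hv => ?_⟩
          refine (Finset.mem_insert.1 (h' hv)).resolve_left ?_
          rintro rfl
          simp [h0] at hv
        · rintro ⟨h, h'⟩
          have h0 : a p = 0 := Finsupp.notMem_support_iff.1 fun h => hp (h' h)
          exact ⟨⟨by rw [h0, zero_add, h], h'.trans (Finset.subset_insert _ _)⟩, h0⟩
      rw [h2, Finset.card_finsuppAntidiag_nat_eq_multichoose,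
        Finset.card_finsuppAntidiag_nat_eq_multichoose, Finset.card_insert_of_notMem hp,
        Nat.multichoose_succ_succ, Nat.multichoose_eq (T.card + 1) 2] at h1
      rw [show T.card + 1 + 2 - 1 = T.card + 2 from rfl,
        show T.card.multichoose (2 + 1) = T.card.multichoose 3 from rfl] at h1
      omega
    have hmem : ∀ a, a ∈ (Finset.finsuppAntidiag (insert p T) 3).filter (fun a => a p ≠ 0) ↔
        (a.support ⊆ insert p T ∧ a.degree = 3) ∧ a p ≠ 0 := by
      intro a
      rw [Finset.mem_filter, Finset.mem_finsuppAntidiag, and_comm (a := _ = 3)]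
      refine and_congr_left fun _ => and_congr_right fun h => ?_
      rw [degree_eq_sum_of_support_subset h]
    have hsum : ∀ a : σ →₀ ℕ, a.support ⊆ insert p T → a.degree = a p + ∑ v ∈ T, a v := by
      intro a ha
      rw [← Finset.sum_insert hp, degree_eq_sum_of_support_subset ha]
    have key : ∀ a b : σ →₀ ℕ, a.support ⊆ insert p T → b.support ⊆ insert p T →
        a.degree = b.degree → a p ≤ b p → a ≠ b → ∃ v ∈ T, b v < a v := by
      intro a b ha hb hab hp' hne
      by_contra! hle
      have h1 := hsum a ha
      have h2 := hsum b hb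
      have h3 := Finset.sum_le_sum hle
      have h4 := (Finset.sum_eq_sum_iff_of_le hle).1 (by omega)
      refine hne (Finsupp.ext fun v => ?_)
      by_cases hv : v ∈ insert p T
      · rcases Finset.mem_insert.1 hv with rfl | hv
        · omega
        · exact h4 v hv
      · rw [Finsupp.notMem_support_iff.1 fun h => hv (ha h),
          Finsupp.notMem_support_iff.1 fun h => hv (hb h)]
    -- The new monomials are those divisible by `x_p`, added by increasing exponent of `p`; each
    -- colon ideal is generated by the variables of `T`.
    have h := ih.union_image 3 (by norm_num) (fun q j h => by rw [ite_ne_right_iff] at h; omega)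
      ((Finset.finsuppAntidiag (insert p T) 3).filter fun a => a p ≠ 0) id (fun a => a p)
      (fun _ => T) (fun a ha => ((hmem a).1 ha).1.2) ?_ ?_ ?_
    · refine h.congr (congrArg _ ?_) fun q j => ?_
      · ext a
        simp only [id, Set.image_id', Set.mem_union, Set.mem_ofPred_eq, Finset.mem_coe, hmem]
        constructor
        · rintro (⟨h1, h2⟩ | h)
          · exact ⟨h1.trans (Finset.subset_insert _ _), h2⟩
          · exact h.1
        · intro h
          by_cases h0 : a p = 0
          · refine Or.inl ⟨fun v hv => (Finset.mem_insert.1 (h.1 hv)).resolve_left ?_, h.2⟩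
            rintro rfl
            simp [h0] at hv
          · exact Or.inr ⟨h, h0⟩
      · simp only [Finset.sum_const, hcard, Finset.card_insert_of_notMem hp, smul_eq_mul,
          Nat.cast_ofNat]
        split_ifs
        -- With `t = T.card`, the new contribution `(t+2).choose 2 * t.choose q` equals
        -- `(t+2).choose (q+2) * (q+2).choose 2`, and Pascal's rule finishes.
        · have h1 := Nat.choose_mul (n := T.card + 2) (k := q + 2) (s := 2) (by omega)
          rw [Nat.add_sub_cancel, Nat.add_sub_cancel] at h1
          rw [← h1, Nat.choose_symm_add (a := q) (b := 2), ← add_mul, add_comm, ← Nat.choose_succ_succ]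
        · rfl
    · intro a ha v hv
      have ha := (hmem a).1 ha
      -- Exchange one factor `x_p` for `x_v`: the resulting cubic divides `x_v x^a` and has smaller
      -- exponent at `p`, so it is already present.
      obtain ⟨b, rfl⟩ : ∃ b, a = Finsupp.single p 1 + b :=
        exists_add_of_le (Finsupp.single_le_iff.2 (Nat.one_le_iff_ne_zero.2 ha.2))
      have hvp : v ≠ p := fun h => hp (h ▸ hv)
      have hle : b + Finsupp.single v 1 ≤ Finsupp.single p 1 + b + Finsupp.single v 1 := by
        rw [add_assoc]
        exact le_add_of_nonneg_left zero_le
      have hsupp : (b + Finsupp.single v 1).support ⊆ insert p T := by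
        refine Finsupp.support_add.trans (Finset.union_subset ?_ ?_)
        · exact (Finsupp.support_mono (le_add_of_nonneg_left zero_le)).trans ha.1.1
        · exact (Finsupp.support_single_subset).trans
            (Finset.singleton_subset_iff.2 (Finset.mem_insert_of_mem hv))
      have hdeg : (b + Finsupp.single v 1).degree = 3 := by
        rw [← ha.1.2, map_add, map_add, Finsupp.degree_single, Finsupp.degree_single, add_comm]
      have hbp : (b + Finsupp.single v 1 : σ →₀ ℕ) p = b p := by simp [hvp.symm]
      by_cases h0 : b p = 0
      · refine Or.inl ⟨_, ⟨fun w hw => (Finset.mem_insert.1 (hsupp hw)).resolve_left ?_, hdeg⟩, hle⟩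
        rintro rfl
        simp only [Finsupp.mem_support_iff, hbp] at hw
        exact hw h0
      · refine Or.inr ⟨_, (hmem _).2 ⟨⟨hsupp, hdeg⟩, by rwa [hbp]⟩, ?_, hle⟩
        rw [hbp, Finsupp.add_apply, Finsupp.single_eq_same]
        omega
    · intro a ha b hb
      have ha := (hmem a).1 ha
      refine key b a (hb.1.trans (Finset.subset_insert _ _)) ha.1.1 (hb.2.trans ha.1.2.symm) ?_ ?_
      · rw [Finsupp.notMem_support_iff.1 fun h => hp (hb.1 h)]
        exact zero_le
      · rintro rfl
        exact hp (hb.1 (Finsupp.mem_support_iff.2 ha.2))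
    · intro a ha b hb hle hne
      have ha := (hmem a).1 ha
      have hb := (hmem b).1 hb
      exact key b a hb.1.1 ha.1.1 (hb.1.2.trans ha.1.2.symm) hle hne

end TriplePoints

/-! ### Generators of degree four. -/

section TriplePoints

variable {σ k : Type*} [Field k]

theorem exists_single_add {a : σ →₀ ℕ} {v : σ} (h : a v ≠ 0) : ∃ b, a = Finsupp.single v 1 + b :=
  exists_add_of_le (Finsupp.single_le_iff.2 (Nat.one_le_iff_ne_zero.2 h))

theorem exists_apply_ne_zero {a : σ →₀ ℕ} (h : a.degree ≠ 0) : ∃ v, a v ≠ 0 := by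
  by_contra! h0
  exact h (by rw [Finsupp.ext h0 (g := 0), map_zero])

/-- The exponents of degree at most `D` of the monomials in the variables `S ∪ T` that vanish to
order three at the coordinate points of `S`. -/
def tripleExps [DecidableEq σ] (S T : Finset σ) (D : ℕ) : Set (σ →₀ ℕ) :=
  {a | a.support ⊆ S ∪ T ∧ 3 ≤ a.degree ∧ a.degree ≤ D ∧ ∀ i ∈ S, a i + 3 ≤ a.degree}

/-- The exponents of the generators `x_i x_U x^W` of degree four, for `U ⊆ S` nonempty. -/
def quarticIndex [DecidableEq σ] (S T : Finset σ) : Finset (Σ _ : ℕ, Finset σ × (σ →₀ ℕ)) :=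
  (Finset.Icc 1 3).sigma fun e => Finset.powersetCard e S ×ˢ Finset.finsuppAntidiag T (3 - e)

theorem mem_quarticIndex [DecidableEq σ] {S T : Finset σ} {x : Σ _ : ℕ, Finset σ × (σ →₀ ℕ)} :
    x ∈ quarticIndex S T ↔ (1 ≤ x.1 ∧ x.1 ≤ 3) ∧ (x.2.1 ⊆ S ∧ x.2.1.card = x.1) ∧
      x.2.2.support ⊆ T ∧ x.2.2.degree = 3 - x.1 := by
  rw [quarticIndex, Finset.mem_sigma, Finset.mem_Icc, Finset.mem_product, Finset.mem_powersetCard,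
    Finset.mem_finsuppAntidiag, and_comm (a := _ = 3 - x.1)]
  refine and_congr_right fun _ => and_congr_right fun _ => and_congr_right fun h => ?_
  rw [degree_eq_sum_of_support_subset h]

/-- Points are added one by one. When `m` points are present, a new point `i` brings the generators
`x_i x_U x^W` with `U` a nonempty set of `e` of the old points and `W` of degree `3 - e` on `T`; `U`
empty would give a multiple of a cubic. The colon ideal is generated by the `T.card + m - e`
variables of `S ∪ T` outside `U`. -/
theorem hasBetti_degree_le_four [DecidableEq σ] (S T : Finset σ) (hST : Disjoint S T) :
    HasBetti (monomialIdeal k (tripleExps S T 4)) fun q j =>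
      (if j = q + 3 then (T.card + 2).choose (q + 3) * (q + 2).choose q else 0) +
      if j = q + 4 then ∑ m ∈ Finset.range S.card, ∑ e ∈ Finset.Icc 1 3,
        m.choose e * T.card.multichoose (3 - e) * (T.card + m - e).choose q else 0 := by
  induction S using Finset.induction_on with
  | empty =>
    refine (hasBetti_cube T).congr (monomialIdeal_eq_of_forall fun c => ?_) fun q j => by simp
    constructor
    · rintro ⟨a, ha, hac⟩
      exact ⟨a, ⟨by simpa using ha.1, ha.2.ge, ha.2.le.trans (by norm_num), by simp⟩, hac⟩
    · rintro ⟨a, ⟨h1, h2, -⟩, hac⟩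
      rw [Finset.empty_union] at h1
      obtain ⟨b, hb, hb'⟩ := a.exists_le_degree_eq 3 h2
      exact ⟨b, ⟨(Finsupp.support_mono hb).trans h1, hb'⟩, hb.trans hac⟩
  | insert i S hi ih =>
    have hST' : Disjoint S T := hST.mono_left (Finset.subset_insert _ _)
    have hiT : i ∉ T := fun h => (Finset.disjoint_left.1 hST) (Finset.mem_insert_self _ _) h
    let mon (x : Σ _ : ℕ, Finset σ × (σ →₀ ℕ)) : σ →₀ ℕ :=
      Finsupp.single i 1 + (subsetExp x.2.1 + x.2.2)
    let V (x : Σ _ : ℕ, Finset σ × (σ →₀ ℕ)) : Finset σ := (S ∪ T) \ x.2.1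
    have happ : ∀ x ∈ quarticIndex S T, ∀ v, v ≠ i → mon x v = subsetExp x.2.1 v + x.2.2 v := by
      intro x _ v hv
      simp [mon, hv.symm]
    have hW : ∀ x ∈ quarticIndex S T, ∀ v ∈ S, x.2.2 v = 0 := fun x hx v hv =>
      Finsupp.notMem_support_iff.1 fun h =>
        Finset.disjoint_left.1 hST' hv ((mem_quarticIndex.1 hx).2.2.1 h)
    have hU : ∀ x ∈ quarticIndex S T, ∀ v ∈ T, subsetExp x.2.1 v = 0 := fun x hx v hv => by
      rw [subsetExp_apply, if_neg fun h =>
        Finset.disjoint_left.1 hST' ((mem_quarticIndex.1 hx).2.1.1 h) hv]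
    have hcardV : ∀ x ∈ quarticIndex S T, (V x).card = T.card + S.card - x.1 := fun x hx => by
      have := mem_quarticIndex.1 hx
      rw [Finset.card_sdiff_of_subset (this.2.1.1.trans Finset.subset_union_left),
        Finset.card_union_of_disjoint hST', this.2.1.2, add_comm]
    have hdeg : ∀ x ∈ quarticIndex S T, (subsetExp x.2.1 + x.2.2).degree = 3 := fun x hx => by
      have := mem_quarticIndex.1 hx
      rw [map_add, degree_subsetExp, this.2.1.2, this.2.2.2]
      omega
    have hdegm : ∀ x ∈ quarticIndex S T, (mon x).degree = 4 := fun x hx => by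
      rw [map_add, Finsupp.degree_single, hdeg x hx]
    have hsupp : ∀ x ∈ quarticIndex S T, (subsetExp x.2.1 + x.2.2).support ⊆ S ∪ T := fun x hx => by
      have := mem_quarticIndex.1 hx
      refine Finsupp.support_add.trans (Finset.union_subset_union (fun v hv => ?_) this.2.2.1)
      rw [Finsupp.mem_support_iff, subsetExp_apply, ite_ne_right_iff] at hv
      exact this.2.1.1 hv.1
    have hne : ∀ v ∈ S ∪ T, v ≠ i := by
      rintro v hv rfl
      exact (Finset.mem_union.1 hv).elim hi hiT
    /- the exponents on `S` and `T` of an exponent that is at most that of `x` on `V x` -/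
    have hle : ∀ x ∈ quarticIndex S T, ∀ a : σ →₀ ℕ, (∀ v ∈ V x, a v ≤ mon x v) →
        (∀ v ∈ S, v ∉ x.2.1 → a v = 0) ∧ ∀ v ∈ T, a v ≤ x.2.2 v := by
      intro x hx a ha
      refine ⟨fun v hv hv' => ?_, fun v hv => ?_⟩
      · have hvST := Finset.mem_union_left T hv
        have := ha v (Finset.mem_sdiff.2 ⟨hvST, hv'⟩)
        rw [happ x hx v (hne v hvST), hW x hx v hv, subsetExp_apply, if_neg hv'] at this
        omega
      · have hvST := Finset.mem_union_right S hv
        have hv' : v ∉ x.2.1 := fun h =>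
          Finset.disjoint_left.1 hST' ((mem_quarticIndex.1 hx).2.1.1 h) hv
        have := ha v (Finset.mem_sdiff.2 ⟨hvST, hv'⟩)
        rwa [happ x hx v (hne v hvST), hU x hx v hv, zero_add] at this
    have hWsum : ∀ x ∈ quarticIndex S T, ∑ v ∈ T, x.2.2 v = 3 - x.1 := fun x hx => by
      have := mem_quarticIndex.1 hx
      rw [← this.2.2.2, degree_eq_sum_of_support_subset this.2.2.1]
    -- The constant rank says that the order among the new quartics is irrelevant: every colon
    -- variable comes from a monomial of the previous ideal.
    have h := (ih hST').union_image 4 (by norm_num) ?_ (quarticIndex S T) mon (fun _ => 0) V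
      hdegm ?_ ?_ ?_
    · refine h.congr (monomialIdeal_eq_of_forall fun c => ?_) fun q j => ?_
      · constructor
        · rintro ⟨a, ⟨h1, h2, h3, h4⟩ | ⟨x, hx, rfl⟩, hac⟩
          · refine ⟨a, ⟨?_, h2, h3, ?_⟩, hac⟩
            · rw [Finset.insert_union]
              exact h1.trans (Finset.subset_insert _ _)
            · intro v hv
              rcases Finset.mem_insert.1 hv with rfl | hv
              · rwa [Finsupp.notMem_support_iff.1 fun h => hne _ (h1 h) rfl, zero_add]
              · exact h4 v hv
          · refine ⟨mon x, ⟨?_, ?_, ?_, ?_⟩, hac⟩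
            · rw [Finset.insert_union]
              refine Finsupp.support_add.trans (Finset.union_subset ?_ ?_)
              · exact Finsupp.support_single_subset.trans
                  (Finset.singleton_subset_iff.2 (Finset.mem_insert_self _ _))
              · exact (hsupp x hx).trans (Finset.subset_insert _ _)
            · rw [hdegm x hx]; norm_num
            · rw [hdegm x hx]
            · intro v hv
              rw [hdegm x hx]
              rcases Finset.mem_insert.1 hv with rfl | hv
              · simp only [mon]
                rw [Finsupp.add_apply, Finsupp.single_eq_same,
                  Finsupp.notMem_support_iff.1 fun h => hne _ (hsupp x hx h) rfl, add_zero]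
              · rw [happ x hx v (hne v (Finset.mem_union_left T hv)), hW x hx v hv,
                  subsetExp_apply]
                split_ifs <;> norm_num
        · rintro ⟨a, ⟨h1, h2, h3, h4⟩, hac⟩
          rw [Finset.insert_union] at h1
          by_cases h0 : a i = 0
          · refine ⟨a, Or.inl ⟨fun v hv => (Finset.mem_insert.1 (h1 hv)).resolve_left ?_, h2, h3,
              fun v hv => h4 v (Finset.mem_insert_of_mem hv)⟩, hac⟩
            rintro rfl
            exact Finsupp.mem_support_iff.1 hv h0
          obtain ⟨b, rfl⟩ := exists_single_add h0
          have hi4 := h4 i (Finset.mem_insert_self _ _)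
          rw [map_add, Finsupp.degree_single] at h2 h3 hi4
          rw [Finsupp.add_apply, Finsupp.single_eq_same] at hi4
          have hb3 : b.degree = 3 := by omega
          have hbi : b i = 0 := by omega
          have hbs : b.support ⊆ S ∪ T := fun v hv => by
            refine (Finset.mem_insert.1 (h1 (Finsupp.support_mono
              (le_add_of_nonneg_left zero_le) hv))).resolve_left ?_
            rintro rfl
            exact Finsupp.mem_support_iff.1 hv hbi
          have hb1 : ∀ v ∈ S, b v ≤ 1 := fun v hv => by
            have := h4 v (Finset.mem_insert_of_mem hv)
            rw [map_add, Finsupp.degree_single, hb3, Finsupp.add_apply] at this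
            omega
          -- If `b` avoids `S`, it is itself a cubic generator; otherwise it splits as a squarefree
          -- part on `S` times a part on `T`.
          by_cases hbS : ∀ v ∈ S, b v = 0
          · exact ⟨b, Or.inl ⟨hbs, hb3.ge, by omega, fun v hv => by rw [hbS v hv, hb3]⟩,
              (le_add_of_nonneg_left zero_le).trans hac⟩
          push Not at hbS
          obtain ⟨u, hu, hbu⟩ := hbS
          let U := S.filter fun v => b v ≠ 0
          let W := b.filter (· ∈ T)
          have hbUW : b = subsetExp U + W := by
            ext v
            rw [Finsupp.add_apply, subsetExp_apply]
            by_cases hvS : v ∈ S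
            · have hvT : v ∉ T := Finset.disjoint_left.1 hST' hvS
              have := hb1 v hvS
              simp only [U, W, Finset.mem_filter, hvS, true_and, Finsupp.filter_apply, hvT,
                if_false]
              split_ifs <;> omega
            · have hvU : v ∉ U := fun h => hvS (Finset.mem_filter.1 h).1
              rw [if_neg hvU, zero_add]
              by_cases hvT : v ∈ T
              · simp [W, hvT]
              · rw [Finsupp.notMem_support_iff.1 fun h =>
                  (Finset.mem_union.1 (hbs h)).elim hvS hvT]
                simp [W, hvT]
          have hcard : U.card + W.degree = 3 := by
            have := congrArg Finsupp.degree hbUW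
            rw [map_add, degree_subsetExp, hb3] at this
            exact this.symm
          have hpos : 0 < U.card := Finset.card_pos.2 ⟨u, Finset.mem_filter.2 ⟨hu, hbu⟩⟩
          refine ⟨_, Or.inr ⟨⟨U.card, U, W⟩, mem_quarticIndex.2 ⟨⟨hpos, ?_⟩,
            ⟨Finset.filter_subset _ _, rfl⟩, ?_, ?_⟩, rfl⟩, ?_⟩
          · dsimp only; omega
          · rw [Finsupp.support_filter]
            exact fun v hv => (Finset.mem_filter.1 hv).2
          · dsimp only; omega
          · rwa [hbUW] at hac
      · rw [add_assoc]
        congr 1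
        simp only [Nat.cast_ofNat, Finset.card_insert_of_notMem hi, Finset.sum_range_succ]
        split_ifs with hj
        · congr 1
          rw [Finset.sum_congr rfl fun x hx => by rw [hcardV x hx], quarticIndex,
            Finset.sum_sigma]
          refine Finset.sum_congr rfl fun e _ => ?_
          dsimp only
          rw [Finset.sum_const, Finset.card_product, Finset.card_powersetCard,
            Finset.card_finsuppAntidiag_nat_eq_multichoose, smul_eq_mul]
        · rfl
    · intro q j h
      by_contra hj
      rw [if_neg (by omega), if_neg (by push_cast at hj; omega)] at h
      exact h rfl
    · intro x hx v hv
      obtain ⟨hv, hvU⟩ := Finset.mem_sdiff.1 hv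
      have hd : (subsetExp x.2.1 + x.2.2 + Finsupp.single v 1).degree = 4 := by
        rw [map_add, hdeg x hx, Finsupp.degree_single]
      -- For `v ∉ U` the quartic `x_U x^W x_v` is still squarefree on `S`, and it does not involve
      -- `x_i`.
      refine Or.inl ⟨subsetExp x.2.1 + x.2.2 + Finsupp.single v 1, ⟨?_, by omega, hd.le, ?_⟩,
        add_le_add_left (le_add_of_nonneg_left zero_le) _⟩
      · exact Finsupp.support_add.trans (Finset.union_subset (hsupp x hx)
          (Finsupp.support_single_subset.trans (Finset.singleton_subset_iff.2 hv)))
      · intro u hu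
        rw [hd, Finsupp.add_apply, Finsupp.add_apply, hW x hx u hu, subsetExp_apply,
          Finsupp.single_apply]
        rcases eq_or_ne v u with rfl | huv
        · rw [if_neg hvU, if_pos rfl]
        · rw [if_neg huv]
          split_ifs <;> norm_num
    · intro x hx a ha
      by_contra! hcon
      -- Degree at most four forces exponents at most one on `S`, so the degree of `a` is at most `e
      -- + (3 - e) = 3`. Being a cubic, `a` then vanishes on `S`, and its degree drops to at most `3
      -- - e < 3`.
      obtain ⟨h1, h2⟩ := hle x hx a hcon
      obtain ⟨ha1, ha2, ha3, ha4⟩ := ha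
      have hx' := mem_quarticIndex.1 hx
      have hsum := degree_eq_sum_add_sum hST' ha1
      have hT := Finset.sum_le_sum h2
      have hS : ∑ v ∈ S, a v ≤ x.1 := by
        rw [← hx'.2.1.2, Finset.card_eq_sum_ones, ← Finset.sum_subset hx'.2.1.1
          fun v hv hv' => h1 v hv hv']
        exact Finset.sum_le_sum fun v hv => by
          have := ha4 v (hx'.2.1.1 hv)
          omega
      rw [hWsum x hx] at hT
      have hS0 : ∑ v ∈ S, a v = 0 := Finset.sum_eq_zero fun v hv => by
        have := ha4 v hv
        omega
      omega
    · intro x hx y hy _ hxy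
      by_contra! hcon
      obtain ⟨h1, h2⟩ := hle x hx _ hcon
      have hx' := mem_quarticIndex.1 hx
      have hy' := mem_quarticIndex.1 hy
      have hUU : y.2.1 ⊆ x.2.1 := fun v hv => by
        by_contra hvx
        have hvS := hy'.2.1.1 hv
        have := h1 v hvS hvx
        rw [happ y hy v (hne v (Finset.mem_union_left T hvS)), subsetExp_apply, if_pos hv] at this
        omega
      have hWW : ∀ v ∈ T, y.2.2 v ≤ x.2.2 v := fun v hv => by
        have := h2 v hv
        rwa [happ y hy v (hne v (Finset.mem_union_right S hv)), hU y hy v hv, zero_add] at this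
      have hT := Finset.sum_le_sum hWW
      have hc := Finset.card_le_card hUU
      rw [hWsum x hx, hWsum y hy] at hT
      rw [hx'.2.1.2, hy'.2.1.2] at hc
      have he : y.1 = x.1 := by omega
      have hUeq := Finset.eq_of_subset_of_card_le hUU (by rw [hx'.2.1.2, hy'.2.1.2, he])
      have hWeq := (Finset.sum_eq_sum_iff_of_le hWW).1 (by rw [hWsum x hx, hWsum y hy, he])
      refine hxy (Sigma.ext he (heq_of_eq (Prod.ext hUeq (Finsupp.ext fun v => ?_))))
      by_cases hv : v ∈ T
      · exact hWeq v hv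
      · rw [Finsupp.notMem_support_iff.1 fun h => hv (hx'.2.2.1 h),
          Finsupp.notMem_support_iff.1 fun h => hv (hy'.2.2.1 h)]

end TriplePoints

/-! ### Generators of degrees five and six. -/

section TriplePoints

variable {k : Type*} [Field k] {N : ℕ} {S : Finset (Fin N)}

theorem mem_tripleExps_compl {D : ℕ} {a : Fin N →₀ ℕ} :
    a ∈ tripleExps S Sᶜ D ↔ 3 ≤ a.degree ∧ a.degree ≤ D ∧ ∀ i ∈ S, a i + 3 ≤ a.degree := by
  simp [tripleExps]

/-- A monomial of degree at least four that has multiplicity exactly three at no more than one of the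
points is divisible by a variable within the ideal. -/
theorem exists_le_degree_add_one {a : Fin N →₀ ℕ} (h4 : 4 ≤ a.degree)
    (ha : ∀ i ∈ S, a i + 3 ≤ a.degree)
    (huniq : ∀ i ∈ S, ∀ j ∈ S, a i + 3 = a.degree → a j + 3 = a.degree → i = j) :
    ∃ b ≤ a, b.degree + 1 = a.degree ∧ ∀ i ∈ S, b i + 3 ≤ b.degree := by
  by_cases h : ∃ i ∈ S, a i + 3 = a.degree
  · obtain ⟨i, hi, hia⟩ := h
    -- Dividing by `x_i` at the only tight point lowers both sides of its inequality; the other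
    -- points have a unit of slack.
    obtain ⟨b, rfl⟩ := exists_single_add (a := a) (v := i) (by omega)
    refine ⟨b, le_add_of_nonneg_left zero_le, by simp [add_comm], fun j hj => ?_⟩
    have h1 := ha j hj
    have h2 := huniq i hi j hj hia
    rw [map_add, Finsupp.degree_single, Finsupp.add_apply] at *
    rcases eq_or_ne i j with rfl | hij
    · rw [Finsupp.single_eq_same] at hia
      omega
    · have := mt h2 hij
      rw [Finsupp.single_eq_of_ne hij.symm] at *
      omega
  · push Not at h
    obtain ⟨v, hv⟩ := exists_apply_ne_zero (a := a) (by omega)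
    obtain ⟨b, rfl⟩ := exists_single_add hv
    refine ⟨b, le_add_of_nonneg_left zero_le, by simp [add_comm], fun j hj => ?_⟩
    have h1 := ha j hj
    have h2 := h j hj
    rw [map_add, Finsupp.degree_single, Finsupp.add_apply] at *
    omega

/-- Pairs `(Q, v)` of a two-element subset `Q` of `S` and `v ∉ Q`, which index the generators
`x_Q ^ 2 * x_v`. -/
def quinticIndex (S : Finset (Fin N)) : Finset (Σ _ : Finset (Fin N), Fin N) :=
  (Finset.powersetCard 2 S).sigma fun Q => Qᶜ

theorem mem_quinticIndex {x : Σ _ : Finset (Fin N), Fin N} :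
    x ∈ quinticIndex S ↔ (x.1 ⊆ S ∧ x.1.card = 2) ∧ x.2 ∉ x.1 := by
  simp [quinticIndex]

/-- Every triple in `S` is counted once, with its minimum as `v`. -/
theorem card_filter_quinticIndex :
    ((quinticIndex S).filter fun x => x.2 ∈ S ∧ ∀ p ∈ x.1, x.2 < p).card = S.card.choose 3 := by
  rw [← Finset.card_powersetCard]
  refine Finset.card_bij (fun x _ => insert x.2 x.1) ?_ ?_ ?_
  · intro x hx
    rw [Finset.mem_filter, mem_quinticIndex] at hx
    rw [Finset.mem_powersetCard, Finset.card_insert_of_notMem hx.1.2, hx.1.1.2]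
    exact ⟨Finset.insert_subset hx.2.1 hx.1.1.1, rfl⟩
  · rintro ⟨Q, v⟩ hx ⟨Q', v'⟩ hx' h
    rw [Finset.mem_filter, mem_quinticIndex] at hx hx'
    dsimp only at hx hx' h
    have hv : v = v' := by
      have h1 : v ∈ insert v' Q' := h ▸ Finset.mem_insert_self _ _
      have h2 : v' ∈ insert v Q := h ▸ Finset.mem_insert_self _ _
      rcases Finset.mem_insert.1 h1 with h1 | h1
      · exact h1
      · rcases Finset.mem_insert.1 h2 with h2 | h2
        · exact h2.symm
        · exact absurd (hx.2.2 _ h2) (hx'.2.2 _ h1).asymm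
    subst hv
    rw [← Finset.erase_insert hx.1.2, h, Finset.erase_insert hx'.1.2]
  · intro P hP
    rw [Finset.mem_powersetCard] at hP
    have hne : P.Nonempty := Finset.card_pos.1 (by omega)
    have hmin := P.min'_mem hne
    refine ⟨⟨P.erase (P.min' hne), P.min' hne⟩, ?_, Finset.insert_erase hmin⟩
    rw [Finset.mem_filter, mem_quinticIndex]
    refine ⟨⟨⟨(Finset.erase_subset _ _).trans hP.1, ?_⟩, Finset.notMem_erase _ _⟩, hP.1 hmin,
      fun p hp => ?_⟩
    · rw [Finset.card_erase_of_mem hmin, hP.2]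
    · exact P.min'_lt_of_mem_erase_min' hne hp

theorem card_quinticIndex :
    (quinticIndex S).card = Sᶜ.card * S.card.choose 2 + 3 * S.card.choose 3 := by
  have h : (quinticIndex S).card = S.card.choose 2 * (N - 2) := by
    rw [quinticIndex, Finset.card_sigma, Finset.sum_congr rfl fun Q hQ => by
      rw [Finset.card_compl, (Finset.mem_powersetCard.1 hQ).2, Fintype.card_fin], Finset.sum_const,
      Finset.card_powersetCard, smul_eq_mul]
  have h1 := Nat.choose_succ_right_eq S.card 2
  have h2 : Sᶜ.card + S.card = N := by
    rw [Finset.card_compl_add_card, Fintype.card_fin]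
  rcases lt_or_ge S.card 2 with hs | hs
  · rw [h, Nat.choose_eq_zero_of_lt hs, Nat.choose_eq_zero_of_lt (by omega : S.card < 3)]
    simp
  · rw [h, show N - 2 = Sᶜ.card + (S.card - 2) by omega, mul_add, ← h1]
    ring

/-- The colon ideal of `x_Q^2 x_v` always contains the variables outside `Q ∪ {v}`, because `x_Q x_v
x_u` is an earlier quartic. It also contains `x_v` if `v ∉ S`, or if some `p ∈ Q` precedes `v`. So
each triple in `S` gives one colon ideal on `N - 3` variables and two on `N - 2`, while each pair
`Q` with `v ∉ S` gives one on `N - 2`. -/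
theorem hasBetti_degree_le_five {c : ℕ → ℤ → ℕ}
    (hc : HasBetti (monomialIdeal k (tripleExps S Sᶜ 4)) c)
    (hc' : ∀ q j, c q j ≠ 0 → j ≤ q + 4) :
    HasBetti (monomialIdeal k (tripleExps S Sᶜ 5)) fun q j => c q j +
      if j = q + 5 then 2 * S.card.choose 3 * (N - 2).choose q + S.card.choose 3 * (N - 3).choose q +
        Sᶜ.card * S.card.choose 2 * (N - 2).choose q else 0 := by
  let first (x : Σ _ : Finset (Fin N), Fin N) : Prop := x.2 ∈ S ∧ ∀ p ∈ x.1, x.2 < p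
  let mon (x : Σ _ : Finset (Fin N), Fin N) : Fin N →₀ ℕ :=
    subsetExp x.1 + subsetExp x.1 + Finsupp.single x.2 1
  let V (x : Σ _ : Finset (Fin N), Fin N) : Finset (Fin N) :=
    if first x then (insert x.2 x.1)ᶜ else x.1ᶜ
  have hdeg : ∀ x ∈ quinticIndex S, (mon x).degree = 5 := fun x hx => by
    simp [mon, degree_subsetExp, (mem_quinticIndex.1 hx).1.2]
  have happ : ∀ x v, mon x v = (if v ∈ x.1 then 2 else 0) + if v = x.2 then 1 else 0 := by
    intro x v
    simp only [mon, Finsupp.add_apply, subsetExp_apply, Finsupp.single_apply, eq_comm (a := v)]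
    split_ifs <;> rfl
  have hmon2 : ∀ x ∈ quinticIndex S, ∀ v, mon x v ≤ 2 := fun x hx v => by
    rw [happ]
    have := (mem_quinticIndex.1 hx).2
    by_cases hv : v ∈ x.1
    · rw [if_pos hv, if_neg (by rintro rfl; exact this hv)]
    · rw [if_neg hv]
      split_ifs <;> norm_num
  have hcardV : ∀ x ∈ quinticIndex S, (V x).card = if first x then N - 3 else N - 2 := by
    intro x hx
    have := mem_quinticIndex.1 hx
    simp only [V]
    split_ifs
    · rw [Finset.card_compl, Finset.card_insert_of_notMem this.2, this.1.2, Fintype.card_fin]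
    · rw [Finset.card_compl, this.1.2, Fintype.card_fin]
  have hVQ : ∀ x, ∀ v ∈ V x, v ∉ x.1 := fun x v hv => by
    simp only [V] at hv
    split_ifs at hv
    · exact fun h => Finset.mem_compl.1 hv (Finset.mem_insert_of_mem h)
    · exact Finset.mem_compl.1 hv
  have h := hc.union_image 5 (by norm_num) (fun q j h => (hc' q j h).trans (by norm_num))
    (quinticIndex S) mon (fun x => x.2) V hdeg ?_ ?_ ?_
  · refine h.congr (monomialIdeal_eq_of_forall fun c => ?_) fun q j => ?_
    · constructor
      · rintro ⟨a, ha | ⟨x, hx, rfl⟩, hac⟩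
        · rw [mem_tripleExps_compl] at ha
          exact ⟨a, mem_tripleExps_compl.2 ⟨ha.1, by omega, ha.2.2⟩, hac⟩
        · refine ⟨mon x, mem_tripleExps_compl.2 ?_, hac⟩
          rw [hdeg x hx]
          exact ⟨by norm_num, le_rfl, fun i _ => Nat.add_le_add_right (hmon2 x hx i) 3⟩
      · rintro ⟨a, ha, hac⟩
        rw [mem_tripleExps_compl] at ha
        obtain ⟨h3, h5, ha⟩ := ha
        by_cases h4 : a.degree ≤ 4
        · exact ⟨a, Or.inl (mem_tripleExps_compl.2 ⟨h3, h4, ha⟩), hac⟩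
        by_cases huniq : ∀ i ∈ S, ∀ j ∈ S, a i + 3 = a.degree → a j + 3 = a.degree → i = j
        · obtain ⟨b, hba, hb, hb'⟩ := exists_le_degree_add_one (by omega) ha huniq
          exact ⟨b, Or.inl (mem_tripleExps_compl.2 ⟨by omega, by omega, hb'⟩), hba.trans hac⟩
        push Not at huniq
        obtain ⟨i, hi, j, hj, hia, hja, hij⟩ := huniq
        -- In degree five, two tight points have exponent two each, which leaves one further
        -- variable `v`.
        have hle : subsetExp {i, j} + subsetExp {i, j} ≤ a := fun v => by
          rw [Finsupp.add_apply, subsetExp_apply]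
          split_ifs with hv
          · rw [Finset.mem_insert, Finset.mem_singleton] at hv
            rcases hv with rfl | rfl <;> omega
          · exact zero_le
        obtain ⟨b, rfl⟩ := exists_add_of_le hle
        have hd : b.degree = 1 := by
          rw [map_add, map_add, degree_subsetExp, Finset.card_pair hij] at h5 h4
          omega
        obtain ⟨v, hv⟩ := exists_apply_ne_zero (a := b) (by omega)
        obtain ⟨b, rfl⟩ := exists_single_add hv
        rw [map_add, Finsupp.degree_single] at hd
        obtain rfl : b = 0 := (Finsupp.degree_eq_zero_iff b).1 (by omega)
        refine ⟨_, Or.inr ⟨⟨{i, j}, v⟩, ?_, rfl⟩, by simpa [mon] using hac⟩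
        refine mem_quinticIndex.2 ⟨⟨?_, Finset.card_pair hij⟩, fun hv => ?_⟩
        · simp [Finset.insert_subset_iff, hi, hj]
        · have hvS : v ∈ S := (Finset.insert_subset hi (Finset.singleton_subset_iff.2 hj)) hv
          have := ha v hvS
          simp only [Finsupp.add_apply, map_add, degree_subsetExp, Finset.card_pair hij,
            subsetExp_apply, if_pos hv, Finsupp.single_eq_same, Finsupp.degree_single, map_zero,
            Finsupp.zero_apply] at this
          omega
    · congr 1
      rw [Nat.cast_ofNat]
      split_ifs
      · have h1 := Finset.card_filter_add_card_filter_not (s := quinticIndex S) first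
        rw [card_quinticIndex, card_filter_quinticIndex] at h1
        rw [Finset.sum_congr rfl fun x hx => by
          rw [hcardV x hx, apply_ite fun m : ℕ => m.choose q], Finset.sum_ite, Finset.sum_const,
          Finset.sum_const, card_filter_quinticIndex, show (Finset.filter (fun x => ¬ first x)
            (quinticIndex S)).card = 2 * S.card.choose 3 + Sᶜ.card * S.card.choose 2 by omega,
          smul_eq_mul, smul_eq_mul]
        ring
      · rfl
  · rintro ⟨Q, v⟩ hx u hu
    obtain ⟨⟨hQS, hQ⟩, hv⟩ := mem_quinticIndex.1 hx
    have huQ := hVQ _ _ hu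
    dsimp only at hQS hQ hv huQ
    by_cases huv : u = v ∧ v ∈ S
    · obtain ⟨rfl, huS⟩ := huv
      have hnf : ¬ first ⟨Q, u⟩ := fun h => by
        simp only [V, if_pos h] at hu
        exact Finset.mem_compl.1 hu (Finset.mem_insert_self _ _)
      obtain ⟨p, hp, hpu⟩ : ∃ p ∈ Q, p ≤ u := by
        by_contra! hall
        exact hnf ⟨huS, hall⟩
      have hne : p ≠ u := fun h => hv (h ▸ hp)
      -- `x_Q^2 x_u^2` is divisible by the quintic that exchanges the roles of `u` and `p`, which is
      -- earlier because `p < u`.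
      refine Or.inr ⟨⟨insert u (Q.erase p), p⟩, mem_quinticIndex.2 ⟨⟨?_, ?_⟩, ?_⟩,
        Fin.lt_def.1 (lt_of_le_of_ne hpu hne), fun w => ?_⟩
      · exact Finset.insert_subset huS ((Finset.erase_subset _ _).trans hQS)
      · rw [Finset.card_insert_of_notMem fun h => hv (Finset.mem_of_mem_erase h),
          Finset.card_erase_of_mem hp, hQ]
      · simp [hne]
      · refine (happ _ w).trans_le ?_
        rw [Finsupp.add_apply, happ, Finsupp.single_apply]
        rcases eq_or_ne w p with rfl | hwp
        · simp only [hp, hne, Finset.mem_insert, Finset.mem_erase, ne_eq, not_true_eq_false, false_and,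
            or_self, if_true, if_false]
          omega
        · rcases eq_or_ne w u with rfl | hwu
          · simp [hwp]
          · simp [hwp, hwu]
    · have hd : (subsetExp Q + Finsupp.single v 1 + Finsupp.single u 1).degree = 4 := by
        simp [degree_subsetExp, hQ]
      refine Or.inl ⟨subsetExp Q + Finsupp.single v 1 + Finsupp.single u 1,
        mem_tripleExps_compl.2 ⟨by omega, hd.le, fun i hi => ?_⟩, ?_⟩
      · rw [hd, Finsupp.add_apply, Finsupp.add_apply, subsetExp_apply, Finsupp.single_apply,
          Finsupp.single_apply]
        by_cases hiQ : i ∈ Q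
        · rw [if_pos hiQ, if_neg (by rintro rfl; exact hv hiQ), if_neg (by rintro rfl; exact huQ hiQ)]
          norm_num
        · rw [if_neg hiQ]
          by_cases hvi : v = i
          · rw [if_pos hvi, if_neg fun h : u = i => huv ⟨h.trans hvi.symm, hvi ▸ hi⟩]
            norm_num
          · rw [if_neg hvi]
            split_ifs <;> norm_num
      · simp only [mon]
        gcongr
        exact le_add_of_nonneg_left zero_le
  · rintro x hx a ha
    by_contra! hcon
    rw [mem_tripleExps_compl] at ha
    obtain ⟨h3, h4, ha⟩ := ha
    obtain ⟨⟨hQS, hQ⟩, hv⟩ := mem_quinticIndex.1 hx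
    -- If `v` is first, `a` lives on three points of `S` with exponents at most one, so its degree
    -- is at most three and all exponents vanish. Otherwise, with `D = deg a`, `D ≤ 2 * (D - 3) + 1`
    -- forces `D ≥ 5`. Both contradict `3 ≤ D ≤ 4`.
    by_cases hf : first x
    · simp only [V, if_pos hf] at hcon
      have hP : (insert x.2 x.1).card = 3 := by rw [Finset.card_insert_of_notMem hv, hQ]
      have hsupp : a.support ⊆ insert x.2 x.1 := fun w hw => by
        by_contra hw'
        have := hcon w (Finset.mem_compl.2 hw')
        rw [Finset.mem_insert, not_or] at hw'
        rw [happ, if_neg hw'.2, if_neg hw'.1] at this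
        exact Finsupp.mem_support_iff.1 hw (by omega)
      have hPS : insert x.2 x.1 ⊆ S := Finset.insert_subset hf.1 hQS
      have hd := degree_eq_sum_of_support_subset hsupp
      have h1 : ∑ i ∈ insert x.2 x.1, a i ≤ ∑ i ∈ insert x.2 x.1, 1 :=
        Finset.sum_le_sum fun i hi => by
          have := ha i (hPS hi)
          omega
      rw [← hd, Finset.sum_const, hP, smul_eq_mul, mul_one] at h1
      rw [Finset.sum_eq_zero fun i hi => by
        have := ha i (hPS hi)
        omega] at hd
      omega
    · simp only [V, if_neg hf] at hcon
      obtain ⟨i, j, hij, hQij⟩ := Finset.card_eq_two.1 hQ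
      have hd := degree_eq_sum_add_sum (S := x.1) (T := x.1ᶜ) disjoint_compl_right (a := a) (by simp)
      have h1 : ∑ w ∈ x.1ᶜ, a w ≤ ∑ w ∈ x.1ᶜ, if w = x.2 then 1 else 0 :=
        Finset.sum_le_sum fun w hw => by
          have := hcon w hw
          rwa [happ, if_neg (Finset.mem_compl.1 hw), zero_add] at this
      rw [Finset.sum_ite_eq', if_pos (Finset.mem_compl.2 hv)] at h1
      rw [hQij, Finset.sum_pair hij, ← hQij] at hd
      have hi := ha i (hQS (by simp [hQij]))
      have hj := ha j (hQS (by simp [hQij]))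
      omega
  · rintro x hx y hy hyx hne
    by_contra! hcon
    obtain ⟨⟨hQS, hQ⟩, hv⟩ := mem_quinticIndex.1 hx
    obtain ⟨⟨hQS', hQ'⟩, hv'⟩ := mem_quinticIndex.1 hy
    suffices h : y.1 ⊆ x.1 ∧ y.2 = x.2 from
      hne (Sigma.ext (Finset.eq_of_subset_of_card_le h.1 (by rw [hQ, hQ'])) (heq_of_eq h.2))
    by_cases hf : first x
    · simp only [V, if_pos hf] at hcon
      have h0 : ∀ w, w ∉ insert x.2 x.1 → w ∉ y.1 ∧ w ≠ y.2 := fun w hw => by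
        have := hcon w (Finset.mem_compl.2 hw)
        rw [Finset.mem_insert, not_or] at hw
        rw [happ, happ, if_neg hw.2, if_neg hw.1] at this
        constructor
        · intro h
          rw [if_pos h] at this
          omega
        · intro h
          rw [if_pos h] at this
          omega
      have h2 : y.2 = x.2 := by
        by_contra h2
        -- If `y.2` lay in `Q`, it would exceed the minimal `x.2`, against the ordering of the
        -- generators.
        refine (h0 y.2 fun h => ?_).2 rfl
        exact (hf.2 _ ((Finset.mem_insert.1 h).resolve_left h2)).not_ge hyx
      refine ⟨fun w hw => ?_, h2⟩
      have : w ∈ insert x.2 x.1 := by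
        by_contra h
        exact (h0 w h).1 hw
      refine (Finset.mem_insert.1 this).resolve_left ?_
      rintro rfl
      exact hv' (h2 ▸ hw)
    · simp only [V, if_neg hf] at hcon
      have h1 : y.1 ⊆ x.1 := fun w hw => by
        by_contra hwx
        have := hcon w (Finset.mem_compl.2 hwx)
        rw [happ, happ, if_pos hw, if_neg hwx] at this
        split_ifs at this <;> omega
      refine ⟨h1, ?_⟩
      have hv'' : y.2 ∉ x.1 := by
        rwa [← Finset.eq_of_subset_of_card_le h1 (by rw [hQ, hQ'])]
      have := hcon y.2 (Finset.mem_compl.2 hv'')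
      rw [happ, happ, if_neg hv', if_neg hv'', if_pos rfl] at this
      by_contra h2
      rw [if_neg h2] at this
      omega

/-- Adding the generators `x_i ^ 3 * x_j ^ 3` gives the whole ideal of triple points. -/
theorem hasBetti_tripleExps {c : ℕ → ℤ → ℕ}
    (hc : HasBetti (monomialIdeal k (tripleExps S Sᶜ 5)) c)
    (hc' : ∀ q j, c q j ≠ 0 → j ≤ q + 5) :
    HasBetti (monomialIdeal k {a | 3 ≤ a.degree ∧ ∀ i ∈ S, a i + 3 ≤ a.degree}) fun q j => c q j +
      if j = q + 6 then S.card.choose 2 * (N - 2).choose q else 0 := by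
  have hle : ∀ Q ∈ Finset.powersetCard 2 S, ∀ a : Fin N →₀ ℕ,
      (∀ v ∈ Qᶜ, a v ≤ (3 • subsetExp Q) v) → ∀ v ∉ Q, a v = 0 := fun Q _ a ha v hv => by
    have := ha v (Finset.mem_compl.2 hv)
    rwa [Finsupp.smul_apply, subsetExp_apply, if_neg hv, smul_zero, Nat.le_zero] at this
  have h := hc.union_image 6 (by norm_num) (fun q j h => (hc' q j h).trans (by norm_num))
    (Finset.powersetCard 2 S) (fun Q => 3 • subsetExp Q) (fun _ => 0) (fun Q => Qᶜ)
    (fun Q hQ => by rw [map_nsmul, degree_subsetExp, (Finset.mem_powersetCard.1 hQ).2]; rfl) ?_ ?_ ?_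
  · refine h.congr (monomialIdeal_eq_of_forall fun c => ?_) fun q j => ?_
    · constructor
      · rintro ⟨a, ha | ⟨Q, hQ, rfl⟩, hac⟩
        · rw [mem_tripleExps_compl] at ha
          exact ⟨a, ⟨ha.1, ha.2.2⟩, hac⟩
        · have hd : (3 • subsetExp Q).degree = 6 := by
            rw [map_nsmul, degree_subsetExp, (Finset.mem_powersetCard.1 hQ).2]; rfl
          refine ⟨3 • subsetExp Q, ⟨by omega, fun i hi => ?_⟩, hac⟩
          rw [hd, Finsupp.smul_apply, subsetExp_apply]
          split_ifs <;> norm_num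
      · rintro ⟨a, ha, hac⟩
        -- Divide by variables until the degree is at most five or two points are tight; in degree
        -- at least six, two tight points have exponents at least three.
        induction hd : a.degree using Nat.strong_induction_on generalizing a with
        | _ m ih =>
          obtain ⟨h3, ha⟩ := ha
          by_cases h5 : a.degree ≤ 5
          · exact ⟨a, Or.inl (mem_tripleExps_compl.2 ⟨h3, h5, ha⟩), hac⟩
          by_cases huniq : ∀ i ∈ S, ∀ j ∈ S, a i + 3 = a.degree → a j + 3 = a.degree → i = j
          · obtain ⟨b, hba, hb, hb'⟩ := exists_le_degree_add_one (by omega) ha huniq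
            exact ih _ (by omega) b ⟨by omega, hb'⟩ (hba.trans hac) rfl
          push Not at huniq
          obtain ⟨i, hi, j, hj, hia, hja, hij⟩ := huniq
          refine ⟨_, Or.inr ⟨{i, j}, ?_, rfl⟩, le_trans (fun v => ?_) hac⟩
          · rw [Finset.mem_coe, Finset.mem_powersetCard]
            exact ⟨Finset.insert_subset hi (Finset.singleton_subset_iff.2 hj), Finset.card_pair hij⟩
          · rw [Finsupp.smul_apply, subsetExp_apply]
            split_ifs with hv
            · rw [Finset.mem_insert, Finset.mem_singleton] at hv
              rcases hv with rfl | rfl <;> rw [smul_eq_mul] <;> omega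
            · exact zero_le
    · rw [Finset.sum_congr rfl fun Q hQ => by
        rw [Finset.card_compl, (Finset.mem_powersetCard.1 hQ).2, Fintype.card_fin], Finset.sum_const,
        Finset.card_powersetCard, smul_eq_mul, Nat.cast_ofNat]
  · intro Q hQ v hv
    rw [Finset.mem_compl] at hv
    have hd : (2 • subsetExp Q + Finsupp.single v 1).degree = 5 := by
      rw [map_add, map_nsmul, degree_subsetExp, (Finset.mem_powersetCard.1 hQ).2,
        Finsupp.degree_single]
      rfl
    -- `x_Q^3 x_v` is a multiple of the quintic `x_Q^2 x_v`, so the colon ideal contains every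
    -- variable outside `Q`.
    refine Or.inl ⟨2 • subsetExp Q + Finsupp.single v 1,
      mem_tripleExps_compl.2 ⟨by omega, hd.le, fun i hi => ?_⟩, ?_⟩
    · rw [hd, Finsupp.add_apply, Finsupp.smul_apply, subsetExp_apply, Finsupp.single_apply]
      by_cases hiQ : i ∈ Q
      · rw [if_pos hiQ, if_neg (by rintro rfl; exact hv hiQ)]
        rfl
      · rw [if_neg hiQ]
        split_ifs <;> norm_num
    · rw [succ_nsmul _ 2]
      gcongr
      exact le_add_of_nonneg_right zero_le
  · intro Q hQ a ha
    by_contra! hcon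
    have h0 := hle Q hQ a hcon
    rw [mem_tripleExps_compl] at ha
    obtain ⟨hQS, hQ2⟩ := Finset.mem_powersetCard.1 hQ
    -- A monomial in `x_i, x_j` alone has degree `D ≤ 2 * (D - 3)`, so `D ≥ 6`, contradicting `D ≤
    -- 5`.
    obtain ⟨i, j, hij, rfl⟩ := Finset.card_eq_two.1 hQ2
    have hd := degree_eq_sum_of_support_subset (U := {i, j}) (a := a) fun v hv => by
      by_contra h
      exact Finsupp.mem_support_iff.1 hv (h0 v h)
    rw [Finset.sum_pair hij] at hd
    have hi := ha.2.2 i (hQS (by simp))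
    have hj := ha.2.2 j (hQS (by simp))
    omega
  · intro Q hQ Q' hQ' _ hne
    by_contra! hcon
    have h0 := hle Q hQ _ hcon
    refine hne (Finset.eq_of_subset_of_card_le (fun v hv => ?_) ?_)
    · by_contra h
      have := h0 v h
      rw [Finsupp.smul_apply, subsetExp_apply, if_pos hv] at this
      exact absurd this (by norm_num)
    · rw [(Finset.mem_powersetCard.1 hQ).2, (Finset.mem_powersetCard.1 hQ').2]

end TriplePoints

/-! ### Linear substitutions and powers of ideals of variables. -/

section CoordinateChange

variable {k : Type*} [Field k] {N : ℕ}

/-- The substitution of linear forms for the variables given by a matrix. -/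
noncomputable def linearSubst (M : Matrix (Fin N) (Fin N) k) :
    MvPolynomial (Fin N) k →ₐ[k] MvPolynomial (Fin N) k :=
  aeval fun j => ∑ l, C (M l j) * X l

theorem linearSubst_comp (M M' : Matrix (Fin N) (Fin N) k) :
    (linearSubst M).comp (linearSubst M') = linearSubst (M * M') := by
  refine algHom_ext fun j => ?_
  simp only [linearSubst, AlgHom.comp_apply, aeval_X, map_sum, map_mul, algHom_C, algebraMap_eq,
    Matrix.mul_apply, Finset.mul_sum, Finset.sum_mul]
  rw [Finset.sum_comm]
  exact Finset.sum_congr rfl fun l _ => Finset.sum_congr rfl fun m _ => by ring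

theorem linearSubst_one : linearSubst (1 : Matrix (Fin N) (Fin N) k) = AlgHom.id k _ := by
  refine algHom_ext fun j => ?_
  simp [linearSubst, Matrix.one_apply, apply_ite (C : k → MvPolynomial (Fin N) k)]

theorem linearSubst_mem_gradedPiece (M : Matrix (Fin N) (Fin N) k) (j : ℤ)
    (f : MvPolynomial (Fin N) k) (hf : f ∈ gradedPiece (Fin N) k j) :
    linearSubst M f ∈ gradedPiece (Fin N) k j := by
  rcases j with m | m
  · have h := IsHomogeneous.aeval (hφ := hf) (g := fun j => ∑ l, C (M l j) * X l) (n := 1)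
      fun j => IsHomogeneous.sum _ _ _ fun l _ => isHomogeneous_C_mul_X _ _
    rwa [one_mul] at h
  · obtain rfl : f = 0 := hf
    rw [map_zero]
    exact Submodule.zero_mem _

/-- Fixes the direction of the coordinate change: row `i` of `M` is the point that the substitution
turns into the `i`-th coordinate point. -/
theorem eval_linearSubst (M : Matrix (Fin N) (Fin N) k) (i : Fin N) (f : MvPolynomial (Fin N) k) :
    eval (Pi.single i 1) (linearSubst M f) = eval (M i) f := by
  have : (aeval (Pi.single i (1 : k))).comp (linearSubst M) = aeval (M i) := by
    refine algHom_ext fun j => ?_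
    simp [linearSubst, Pi.single_apply]
  exact DFunLike.congr_fun this f

theorem gradedComponent_linearSubst (M : Matrix (Fin N) (Fin N) k) (j : ℤ)
    (f : MvPolynomial (Fin N) k) :
    linearSubst M (gradedComponent j f) = gradedComponent j (linearSubst M f) := by
  have hne : ∀ {i} {g : MvPolynomial (Fin N) k}, g ∈ gradedPiece (Fin N) k i → i ≠ j →
      gradedComponent j g = 0 := by
    intro i g hg hij
    ext c
    rw [coeff_gradedComponent, coeff_zero, ite_eq_right_iff]
    intro hc
    by_contra h
    exact hij ((mem_gradedPiece.1 hg c h).symm.trans hc)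
  induction f using MvPolynomial.induction_on' with
  | monomial d a =>
    have hd : monomial d a ∈ gradedPiece (Fin N) k d.degree := isHomogeneous_monomial a rfl
    by_cases h : (d.degree : ℤ) = j
    · rw [h] at hd
      rw [gradedComponent_of_mem hd,
        gradedComponent_of_mem (linearSubst_mem_gradedPiece M _ _ hd)]
    · rw [hne hd h, hne (linearSubst_mem_gradedPiece M _ _ hd) h, map_zero]
  | add f g hf hg => rw [map_add, map_add, map_add, map_add, hf, hg]

theorem eval_single_of_isHomogeneous {f : MvPolynomial (Fin N) k} {m : ℕ}
    (hf : f.IsHomogeneous m) (i : Fin N) :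
    eval (Pi.single i 1) f = coeff (Finsupp.single i m) f := by
  rw [eval_eq', Finset.sum_eq_single (Finsupp.single i m)]
  · rw [Finset.prod_eq_one, mul_one]
    intro j _
    rcases eq_or_ne j i with rfl | hji
    · simp
    · simp [hji]
  · intro d hd hne
    have : ∃ j ≠ i, d j ≠ 0 := by
      by_contra! h
      have hd1 : d = Finsupp.single i (d i) := by
        ext j
        rcases eq_or_ne j i with rfl | hji
        · simp
        · simp [h j hji, hji]
      have := hf.degree_eq_sum_deg_support hd
      rw [← Finsupp.degree_apply, hd1, Finsupp.degree_single] at this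
      exact hne (by rw [hd1, ← this])
    obtain ⟨j, hji, hj⟩ := this
    rw [Finset.prod_eq_zero (Finset.mem_univ j) (by simp [hji, hj]), mul_zero]
  · intro h
    rw [notMem_support_iff.1 h, zero_mul]

theorem span_X_pow (W : Finset (Fin N)) (p : ℕ) :
    (Ideal.span (X '' (W : Set (Fin N))) : Ideal (MvPolynomial (Fin N) k)) ^ p =
      monomialIdeal k {a | p ≤ ∑ j ∈ W, a j} := by
  induction p with
  | zero =>
    rw [pow_zero, Ideal.one_eq_top, eq_comm, Ideal.eq_top_iff_one, mem_monomialIdeal]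
    exact fun c _ => ⟨c, Nat.zero_le _, le_rfl⟩
  | succ p ih =>
    rw [pow_succ, ih, monomialIdeal, monomialIdeal, Ideal.span_mul_span']
    refine le_antisymm (Ideal.span_le.2 ?_) (Ideal.span_le.2 ?_)
    · rintro _ ⟨_, ⟨a, ha, rfl⟩, _, ⟨j, hj, rfl⟩, rfl⟩
      refine Ideal.subset_span ⟨a + Finsupp.single j 1, ?_, ?_⟩
      · have : ∑ x ∈ W, Finsupp.single j 1 x = 1 := by
          simp only [Finsupp.single_apply, Finset.sum_ite_eq, if_pos (Finset.mem_coe.1 hj)]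
        simp only [Set.mem_ofPred_eq, Finsupp.add_apply, Finset.sum_add_distrib, this] at ha ⊢
        omega
      · simp [X, monomial_mul]
    · rintro _ ⟨a, ha, rfl⟩
      obtain ⟨j, hj, haj⟩ : ∃ j ∈ W, a j ≠ 0 := by
        by_contra! h
        rw [Set.mem_ofPred_eq, Finset.sum_eq_zero h] at ha
        omega
      obtain ⟨b, rfl⟩ := exists_single_add haj
      refine Ideal.subset_span ⟨monomial b 1, ⟨b, ?_, rfl⟩, X j, ⟨j, hj, rfl⟩, ?_⟩
      · have : ∑ x ∈ W, Finsupp.single j 1 x = 1 := by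
          simp only [Finsupp.single_apply, Finset.sum_ite_eq, if_pos hj]
        simp only [Set.mem_ofPred_eq, Finsupp.add_apply, Finset.sum_add_distrib, this] at ha ⊢
        omega
      · simp [X, monomial_mul, add_comm]

end CoordinateChange

/-! ### Reduction to coordinate points. -/

section GeneralPosition

variable {k : Type*} [Field k] {n r : ℕ}

/-- A linearly independent family extends to a basis, given by the rows of an invertible matrix. -/
theorem exists_isUnit_rows {m N : ℕ} (h : m ≤ N) {v : Fin m → Fin N → k}
    (hv : LinearIndependent k v) :
    ∃ M : Matrix (Fin N) (Fin N) k, IsUnit M ∧ ∀ i, M (Fin.castLE h i) = v i := by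
  classical
  have hrange := hv.linearIndepOn_id
  let b := Module.Basis.extend hrange
  have : Finite (hrange.extend (Set.subset_univ _)) := b.linearIndependent.finite
  have := Fintype.ofFinite (hrange.extend (Set.subset_univ _))
  have hcard : Fintype.card (Fin N) = (hrange.extend (Set.subset_univ _)).toFinset.card := by
    rw [Set.toFinset_card, ← Module.finrank_eq_card_basis b, Module.finrank_fin_fun,
      Fintype.card_fin]
  -- The default value zero plays no role: the bijection with the basis is only required to agree
  -- with `f` on the first `m` indices.
  let f (i : Fin N) : Fin N → k := if hi : i.1 < m then v ⟨i, hi⟩ else 0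
  have hf : ∀ i, f (Fin.castLE h i) = v i := fun i => dif_pos i.2
  obtain ⟨g, hg⟩ := Set.MapsTo.exists_equiv_extend_of_card_eq hcard
    (s := Set.range (Fin.castLE h)) (f := f)
    (by
      rintro _ ⟨i, rfl⟩
      rw [hf, Set.coe_toFinset]
      exact hrange.subset_extend _ ⟨i, rfl⟩)
    (by
      rintro _ ⟨i, rfl⟩ _ ⟨j, rfl⟩ hij
      rw [hf, hf] at hij
      rw [hv.injective hij])
  have hg' : ∀ i, (g i : Fin N → k) ∈ hrange.extend (Set.subset_univ _) :=
    fun i => Set.mem_toFinset.1 (g i).2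
  refine ⟨fun i => g i, Matrix.linearIndependent_rows_iff_isUnit.1 ?_,
    fun i => (hg _ ⟨i, rfl⟩).trans (hf i)⟩
  have h1 := b.linearIndependent.comp (fun i => ⟨g i, hg' i⟩) fun i j hij =>
    g.injective (Subtype.ext (Subtype.mk.inj hij))
  have h2 : (b ∘ fun i => ⟨g i, hg' i⟩) = fun i => (g i : Fin N → k) := by
    ext i : 1
    exact Module.Basis.extend_apply_self hrange ⟨g i, hg' i⟩
  rw [h2] at h1
  exact h1

theorem map_pointIdeal (M : Matrix (Fin (n + 1)) (Fin (n + 1)) k)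
    (φ : MvPolynomial (Fin (n + 1)) k ≃ₐ[k] MvPolynomial (Fin (n + 1)) k)
    (hφ : ∀ f, φ f = linearSubst M f) (hφ' : ∀ f, φ.symm f = linearSubst M⁻¹ f)
    (P : Projectivization k (Fin (n + 1) → k)) (i : Fin (n + 1)) (hi : M i = P.rep) :
    (pointIdeal P).map φ = Ideal.span (X '' (({i}ᶜ : Finset (Fin (n + 1))) : Set (Fin (n + 1)))) := by
  have heval : ∀ f, eval (Pi.single i 1) (φ f) = eval P.rep f := fun f => by
    rw [hφ, eval_linearSubst, hi]
  rw [pointIdeal, Ideal.map_span]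
  refine le_antisymm (Ideal.span_le.2 ?_) (Ideal.span_le.2 ?_)
  · rintro _ ⟨f, ⟨⟨m, hm⟩, hf⟩, rfl⟩
    have hm' : (φ f).IsHomogeneous m := hφ f ▸ linearSubst_mem_gradedPiece M m f hm
    rw [SetLike.mem_coe, mem_ideal_span_X_image]
    intro c hc
    by_contra! h
    -- The only monomial of degree `m` free of the other variables is `x_i^m`, and its coefficient
    -- in a form is the value at the coordinate point, which is zero here.
    have hc' : c = Finsupp.single i m := by
      have hd1 : c = Finsupp.single i (c i) := by
        ext j
        rcases eq_or_ne j i with rfl | hji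
        · simp
        · simp [h j (by simpa using hji), hji]
      have := hm'.degree_eq_sum_deg_support hc
      rw [← Finsupp.degree_apply, hd1, Finsupp.degree_single] at this
      rw [hd1, ← this]
    rw [mem_support_iff, hc', ← eval_single_of_isHomogeneous hm', heval] at hc
    exact hc hf
  · rintro _ ⟨j, hj, rfl⟩
    refine Ideal.subset_span ⟨φ.symm (X j), ⟨⟨1, ?_⟩, ?_⟩, φ.apply_symm_apply _⟩
    · rw [hφ']
      exact linearSubst_mem_gradedPiece _ 1 _ (isHomogeneous_X k j)
    · have : j ≠ i := by simpa using hj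
      rw [← heval, φ.apply_symm_apply, eval_X, Pi.single_eq_of_ne this]

/-- A monomial lies in the cube of the ideal of the `i`-th coordinate point iff its degree in the
other variables, `deg a - a i`, is at least three; an intersection of monomial ideals is tested
monomial by monomial. There is at least one point, so `3 ≤ deg a` follows. -/
theorem iInf_span_X_pow {m N : ℕ} (e : Fin (m + 1) → Fin N) :
    ⨅ i, (Ideal.span (X '' (({e i}ᶜ : Finset (Fin N)) : Set (Fin N))) :
      Ideal (MvPolynomial (Fin N) k)) ^ 3 =
    monomialIdeal k {a | 3 ≤ a.degree ∧ ∀ i ∈ Finset.univ.image e, a i + 3 ≤ a.degree} := by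
  have hsum : ∀ (i : Fin N) (a : Fin N →₀ ℕ), a i + ∑ j ∈ {i}ᶜ, a j = a.degree := fun i a => by
    rw [Finsupp.degree_eq_sum, Fintype.sum_eq_add_sum_compl i]
  ext f
  simp only [Submodule.mem_iInf, span_X_pow, mem_monomialIdeal]
  constructor
  · intro h c hc
    have h3 : ∀ i, c (e i) + 3 ≤ c.degree := fun i => by
      obtain ⟨a, ha, hac⟩ := h i c hc
      rw [← hsum (e i) c]
      exact Nat.add_le_add_left (le_trans ha (Finset.sum_le_sum fun j _ => hac j)) _
    refine ⟨c, ⟨(Nat.le_add_left _ _).trans (h3 0), fun i hi => ?_⟩, le_rfl⟩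
    obtain ⟨i, -, rfl⟩ := Finset.mem_image.1 hi
    exact h3 i
  · intro h i c hc
    obtain ⟨a, ⟨-, ha⟩, hac⟩ := h c hc
    refine ⟨a, ?_, hac⟩
    have := ha (e i) (Finset.mem_image_of_mem _ (Finset.mem_univ _))
    rw [← hsum (e i) a] at this
    exact Nat.add_le_add_iff_left.1 this

theorem hasBetti_fatPointIdeal (hr : r + 1 ≤ n + 1)
    (P : Fin (r + 1) → Projectivization k (Fin (n + 1) → k))
    (hP : Projectivization.Independent P) {c : ℕ → ℤ → ℕ}
    (hc : HasBetti (monomialIdeal k {a | 3 ≤ a.degree ∧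
      ∀ i ∈ Finset.univ.image (Fin.castLE hr), a i + 3 ≤ a.degree}) c) :
    HasBetti (fatPointIdeal P fun _ => 3) c := by
  obtain ⟨M, hM, hMP⟩ := exists_isUnit_rows hr (Projectivization.independent_iff.1 hP)
  have hdet := (Matrix.isUnit_iff_isUnit_det M).1 hM
  let φ : MvPolynomial (Fin (n + 1)) k ≃ₐ[k] MvPolynomial (Fin (n + 1)) k :=
    AlgEquiv.ofAlgHom (linearSubst M) (linearSubst M⁻¹)
      (by rw [linearSubst_comp, Matrix.mul_nonsing_inv _ hdet, linearSubst_one])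
      (by rw [linearSubst_comp, Matrix.nonsing_inv_mul _ hdet, linearSubst_one])
  have hmem : ∀ f, f ∈ fatPointIdeal P (fun _ => 3) ↔ φ f ∈ monomialIdeal k {a | 3 ≤ a.degree ∧
      ∀ i ∈ Finset.univ.image (Fin.castLE hr), a i + 3 ≤ a.degree} := by
    intro f
    rw [← iInf_span_X_pow, fatPointIdeal, Submodule.mem_iInf, Submodule.mem_iInf]
    refine forall_congr' fun i => ?_
    rw [← map_pointIdeal M φ (fun _ => rfl) (fun _ => rfl) (P i) _ (hMP i), ← Ideal.map_pow]
    constructor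
    · exact Ideal.mem_map_of_mem _
    · intro h
      obtain ⟨g, hg, hgf⟩ := (Ideal.mem_map_of_equiv φ _).1 h
      rwa [← φ.injective hgf]
  refine hc.mapEquiv φ.symm (fun j f hf => linearSubst_mem_gradedPiece _ j f hf) (fun f => ?_) ?_
  · rw [hmem, φ.apply_symm_apply]
  · intro f hf j
    rw [hmem] at hf ⊢
    have := hc.1 _ hf j
    rwa [show φ f = linearSubst M f from rfl, ← gradedComponent_linearSubst] at this

end GeneralPosition

/-! ### Reindexing the quartic sum and assembling the Betti table. -/

/-- Substitutes `m = r - i`. The terms with `m < e` vanish with `m.choose e`, which shortens the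
range and makes the truncated subtractions there harmless. -/
theorem sum_range_choose_reflect (r e : ℕ) (f g : ℕ → ℕ) (h : ∀ i < r + 1 - e, f (r - i) = g i) :
    ∑ m ∈ Finset.range (r + 1), m.choose e * f m =
      ∑ i ∈ Finset.range (r + 1 - e), (r - i).choose e * g i := by
  rw [← Finset.sum_range_reflect, ← Finset.sum_subset (Finset.range_mono (Nat.sub_le (r + 1) e))]
  · refine Finset.sum_congr rfl fun i hi => ?_
    rw [← h i (Finset.mem_range.1 hi), show r + 1 - 1 - i = r - i by omega]
  · intro i hi hi'
    rw [Finset.mem_range] at hi hi'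
    rw [Nat.choose_eq_zero_of_lt (by omega), zero_mul]

theorem sum_quartic (n r q : ℕ) (hr : r ≤ n) :
    ∑ m ∈ Finset.range (r + 1), ∑ e ∈ Finset.Icc 1 3,
      m.choose e * (n - r).multichoose (3 - e) * (n - r + m - e).choose q =
    (∑ i ∈ Finset.range r, (r - i) * (n - r + 1).choose 2 * (n - i - 1).choose q) +
      (∑ i ∈ Finset.range (r - 1), (r - i).choose 2 * (n - r) * (n - i - 2).choose q) +
      ∑ i ∈ Finset.range (r - 2), (r - i).choose 3 * (n - i - 3).choose q := by
  have h1 : Finset.Icc 1 3 = {1, 2, 3} := rfl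
  have h2 : (n - r).multichoose 2 = (n - r + 1).choose 2 := by rw [Nat.multichoose_eq]; rfl
  simp only [h1, Finset.sum_insert (show 1 ∉ ({2, 3} : Finset ℕ) by decide),
    Finset.sum_insert (show 2 ∉ ({3} : Finset ℕ) by decide), Finset.sum_singleton,
    Finset.sum_add_distrib, mul_assoc, ← add_assoc]
  rw [sum_range_choose_reflect r 1 _ (fun i => (n - r + 1).choose 2 * (n - i - 1).choose q),
    sum_range_choose_reflect r 2 _ (fun i => (n - r) * (n - i - 2).choose q),
    sum_range_choose_reflect r 3 _ (fun i => (n - i - 3).choose q)]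
  · simp
  · intro i hi
    rw [Nat.sub_self, Nat.multichoose_zero_right, one_mul, show n - r + (r - i) = n - i by omega]
  · intro i hi
    rw [Nat.multichoose_one_right, show n - r + (r - i) = n - i by omega]
  · intro i hi
    rw [h2, show n - r + (r - i) = n - i by omega]

end FatPoints

theorem proposition3p3 {k : Type*} [Field k] (n r : ℕ) (hr : r + 1 ≤ n + 1)
    (P : Fin (r + 1) → Projectivization k (Fin (n + 1) → k))
    (hP : Projectivization.Independent P) :
    Nonempty (FatPoints.MinimalGradedFreeResolution (σ := Fin (n + 1))
      (FatPoints.quotientPiece (FatPoints.fatPointIdeal P fun _ => 3))) ∧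
    ∀ F : FatPoints.MinimalGradedFreeResolution (σ := Fin (n + 1))
        (FatPoints.quotientPiece (FatPoints.fatPointIdeal P fun _ => 3)),
      F.betti 0 0 = 1 ∧
      (∀ q : ℕ, 1 ≤ q →
        F.betti q (q + 2) = (n - r + 2).choose (q + 2) * (q + 1).choose (q - 1) ∧
        F.betti q (q + 3) =
          (∑ i ∈ Finset.range r, (r - i) * (n - r + 1).choose 2 * (n - i - 1).choose (q - 1)) +
          (∑ i ∈ Finset.range (r - 1),
            (r - i).choose 2 * (n - r) * (n - i - 2).choose (q - 1)) +
          (∑ i ∈ Finset.range (r - 2), (r - i).choose 3 * (n - i - 3).choose (q - 1)) ∧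
        F.betti q (q + 4) =
          2 * (r + 1).choose 3 * (n - 1).choose (q - 1) +
          (r + 1).choose 3 * (n - 2).choose (q - 1) +
          (n - r) * (r + 1).choose 2 * (n - 1).choose (q - 1) ∧
        F.betti q (q + 5) = (r + 1).choose 2 * (n - 1).choose (q - 1)) ∧
      (∀ (q : ℕ) (j : ℤ), ¬(q = 0 ∧ j = 0) →
        ¬(1 ≤ q ∧ (q : ℤ) + 2 ≤ j ∧ j ≤ (q : ℤ) + 5) → F.betti q j = 0) := by
  have hS : (Finset.univ.image (Fin.castLE hr)).card = r + 1 := by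
    rw [Finset.card_image_of_injective _ (Fin.castLE_injective hr), Finset.card_univ,
      Fintype.card_fin]
  have hT : (Finset.univ.image (Fin.castLE hr))ᶜ.card = n - r := by
    rw [Finset.card_compl, hS, Fintype.card_fin]
    omega
  have h4 := FatPoints.hasBetti_degree_le_four (k := k) _ _
    (disjoint_compl_right (a := Finset.univ.image (Fin.castLE hr)))
  have h5 := FatPoints.hasBetti_degree_le_five h4 fun q j h => by
    by_contra hj
    rw [if_neg (by omega), if_neg (by omega)] at h
    exact h rfl
  have h6 := FatPoints.hasBetti_tripleExps h5 fun q j h => by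
    by_contra hj
    rw [if_neg (by omega), if_neg (by omega), if_neg (by omega)] at h
    exact h rfl
  simp only [hS, hT, FatPoints.sum_quartic n r _ (Nat.le_of_succ_le_succ hr)] at h6
  obtain ⟨hne, hF⟩ := (FatPoints.hasBetti_fatPointIdeal hr P hP h6).minimalGradedFreeResolution
  refine ⟨hne, fun F => ?_⟩
  obtain ⟨hF0, hF1⟩ := hF F
  refine ⟨by rw [hF0, if_pos rfl], ?_, ?_⟩
  · rintro (_ | q) hq
    · omega
    refine ⟨?_, ?_, ?_, ?_⟩
    -- The table is indexed by homological degree minus one, so generators of degree `d` produce the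
    -- strand `j = (q + 1) + (d - 1)`.
    · rw [hF1, if_pos (by push_cast; ring), if_neg (by omega), if_neg (by omega),
        if_neg (by omega)]
      rfl
    · rw [hF1, if_neg (by omega), if_pos (by push_cast; ring), if_neg (by omega),
        if_neg (by omega), zero_add]
      rfl
    · rw [hF1, if_neg (by omega), if_neg (by omega), if_pos (by push_cast; ring),
        if_neg (by omega), zero_add, zero_add]
      rfl
    · rw [hF1, if_neg (by omega), if_neg (by omega), if_neg (by omega),
        if_pos (by push_cast; ring), zero_add, zero_add, zero_add]
      rfl
  · rintro (_ | q) j h0 h1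
    · rw [hF0, if_neg (by simpa using h0)]
    · rw [hF1, if_neg (by omega), if_neg (by omega), if_neg (by omega), if_neg (by omega)]
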